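/- Let $F$ be a non-Archimedean local field with ring of integers $\mathcal{O}_F$, uniformizer $\varpi$, residue field of odd cardinality $q$, and absolute value normalized by $|\varpi|=q^{-1}$. Let $D=M_2(F)$ and $\mathcal{O}_D=M_2(\mathcal{O}_F)$, with reduced trace $\mathrm{trd}=\mathrm{tr}$, reduced norm $\mathrm{nrd}=\det$ and standard involution $x\mapsto x^\dagger$ (the adjugate). For nonzero $x\in D$ let $v(x)=\max\{e\in\mathbb{Z}: x\in\varpi^e\mathcal{O}_D\}$, and let $\|\cdot\|$ denote the maximum of the absolute values of the matrix entries, on $D$ and on $D^n$. Let $\psi$ be an additive character of $F$ that is trivial on $\mathcal{O}_F$ but not on $\varpi^{-1}\mathcal{O}_F$. Let $dY$ be the Haar measure on $D$ with $\mathrm{vol}(\mathcal{O}_D)=1$ (the measure that is self-dual for $\psi$), and use the product measure on $D^n$. Let $n\ge 1$, let $\upsilon_1,\dots,\upsilon_n\in\mathcal{O}_F^\times$, and put $P(Y)=\sum_{i}\upsilon_iY_i^2$. For $\delta\in D^\times$ and $\gamma\in D^n$ define $$I_0(\delta,\gamma)=\mathbf{1}_{\mathcal{O}_D}(\delta)\int_{\mathcal{O}_D^n}\mathbf{1}_{\mathcal{O}_D}(\delta^{-1}P(Y))\,\psi\!\left(\frac{\mathrm{trd}(\sum_i\gamma_iY_i)}{\mathrm{nrd}(\delta)}\right)dY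 .$$ Write $\delta=\varpi^{v(\delta)}\eta$, so that $\eta\in\mathcal{O}_D-\varpi\mathcal{O}_D$. There exists $N_0\in\mathcal{O}_D$ such that $\eta^\dagger N_0\eta$ generates, as an $\mathcal{O}_F$-module, the image of $\eta^\dagger\mathcal{O}_D\eta$ in $\mathcal{O}_D/\mathrm{nrd}(\eta)\mathcal{O}_D$. Let $N_0$ be any such element, and for $M_0\in\mathcal{O}_D$ put $$\mathcal{W}(M_0,\eta)=\sup_{\mu\in\mathcal{O}_F^n-\varpi\mathcal{O}_F^n}\mathrm{vol}\left\{Z\in\mathcal{O}_D:\ \exists\,\lambda\in\mathcal{O}_F^n\ \text{with}\ \mu_iM_0-\lambda_iZ\eta^\dagger N_0\in\mathcal{O}_D\eta^\dagger\ \text{for all } i\right\}.$$ Then $I_0(\delta,\gamma)=0$ unless $\gamma\in\varpi^{v(\delta)}\mathcal{O}_D^n$ and, with $\gamma':=\varpi^{-v(\delta)}\gamma$, there exist $M_0\in\mathcal{O}_D$ and $\mu\in\mathcal{O}_F^n-\varpi\mathcal{O}_F^n$ such that $$\gamma'\eta\in\mu M_0\eta+\mathrm{nrd}(\eta)\mathcal{O}_D^n.\qquad(*)$$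 Moreover, if $\gamma\in\varpi^{v(\delta)}\mathcal{O}_D^n$, then for every $M_0\in\mathcal{O}_D$ and $\mu\in\mathcal{O}_F^n-\varpi\mathcal{O}_F^n$ satisfying $(*)$, $$|I_0(\delta,\gamma)|\le\frac{\mathcal{W}(M_0,\eta)\,|\mathrm{nrd}(\eta)|^{3n/2}\,\|\delta\|^n}{\max\left(\|(\gamma'-\gamma'^\dagger)\eta\|,|\mathrm{nrd}(\eta)|\right)^{n/2}\,\max\left(\|\gamma'\|,\|\delta\||\mathrm{nrd}(\eta)|\right)^n}.$$ -/

import Mathlib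

open MeasureTheory

noncomputable section

namespace SplitPlace

/-! Throughout, `F` is a non-Archimedean local field: a nontrivially normed field whose norm is
ultrametric and whose closed balls are compact. The split quaternion algebra over `F` is
`D = M₂(F)`, with maximal order `O_D = M₂(O_F)`; the reduced trace is `Matrix.trace`, the reduced
norm is `Matrix.det`, and the standard involution `†` is `Matrix.adjugate`. -/

/-- The split quaternion algebra `D = M₂(F)`. -/
abbrev D (F : Type*) : Type _ := Matrix (Fin 2) (Fin 2) F

section Field

variable {F : Type*} [NontriviallyNormedField F]

/-- The cardinality `q` of the residue field of `F`. -/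
def residueCard (F : Type*) [NontriviallyNormedField F] [IsUltrametricDist F] : ℕ :=
  Nat.card (IsLocalRing.ResidueField (NormedField.valuation (K := F)).valuationSubring)

/-- `ϖ` is a uniformizer of `F`: a nonzero generator of the maximal ideal `{x : |x| < 1}`. -/
def IsUniformizer (ϖ : F) : Prop :=
  ϖ ≠ 0 ∧ ‖ϖ‖ < 1 ∧ ∀ x : F, ‖x‖ < 1 → ‖x‖ ≤ ‖ϖ‖

/-- The additive character `ψ` is unramified (of conductor `0`): it is trivial on `O_F`,
but not on `ϖ⁻¹ O_F`. -/
def IsUnramified (ϖ : F) (ψ : AddChar F Circle) : Prop :=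
  (∀ x : F, ‖x‖ ≤ 1 → ψ x = 1) ∧ ∃ x : F, ‖x‖ ≤ 1 ∧ ψ (ϖ⁻¹ * x) ≠ 1

/-- The maximal order `O_D = M₂(O_F)`, as a subset of `D`. -/
def OD (F : Type*) [NontriviallyNormedField F] : Set (D F) :=
  {A | ∀ a b, ‖A a b‖ ≤ 1}

/-- The valuation `v(x) = max {e ∈ ℤ : x ∈ ϖ ^ e O_D}` of a nonzero element `x` of `D`. -/
def ordD (ϖ : F) (x : D F) : ℤ :=
  sSup {e : ℤ | ∃ y ∈ OD F, x = ϖ ^ e • y}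

/-- The box norm on `D`: the maximum of the absolute values of the entries. -/
def boxNorm (x : D F) : ℝ :=
  ‖fun p : Fin 2 × Fin 2 => x p.1 p.2‖

/-- The box norm on `Dⁿ`. -/
def boxNormVec {n : ℕ} (x : Fin n → D F) : ℝ :=
  ‖fun p : Fin n × Fin 2 × Fin 2 => x p.1 p.2.1 p.2.2‖

/-- `m` is primitive: `m ∈ O_Fⁿ - ϖ O_Fⁿ`. -/
def IsPrimitiveVec (ϖ : F) {n : ℕ} (m : Fin n → F) : Prop :=
  (∀ i, ‖m i‖ ≤ 1) ∧ ¬ ∃ l : Fin n → F, (∀ i, ‖l i‖ ≤ 1) ∧ m = ϖ • l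

/-- The diagonal quadratic polynomial `P(Y) = ∑ υᵢ Yᵢ²` on `Dⁿ`. -/
def diagForm {n : ℕ} (υ : Fin n → F) (Y : Fin n → D F) : D F :=
  ∑ i, υ i • Y i ^ 2

/-- The local integral
`I₀(f, Φ, δ, γ) = ∫_{Dⁿ} f(Y) Φ(δ, δ⁻¹ P(Y)) ψ(trd(γ · Y) / nrd δ) dY`,
where `dY` is the product measure on `Dⁿ` of the measure `μ` on `D`. -/
def I0 [MeasurableSpace (D F)] (μ : Measure (D F)) (ψ : AddChar F Circle) {n : ℕ}
    (P : (Fin n → D F) → D F) (f : (Fin n → D F) → ℂ) (Φ : D F × D F → ℂ)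
    (δ : D F) (γ : Fin n → D F) : ℂ :=
  ∫ Y : Fin n → D F,
    f Y * Φ (δ, δ⁻¹ * P Y) * (ψ ((∑ i, γ i * Y i).trace / δ.det) : ℂ)
    ∂(Measure.pi fun _ => μ)

/-- The standard test function on `Dⁿ`: the indicator function of `O_Dⁿ`. -/
def stdf (F : Type*) [NontriviallyNormedField F] (n : ℕ) : (Fin n → D F) → ℂ :=
  Set.indicator {Y | ∀ i, Y i ∈ OD F} 1

/-- The standard test function on `D²`: the indicator function of `O_D²`. -/
def stdΦ (F : Type*) [NontriviallyNormedField F] : D F × D F → ℂ :=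
  Set.indicator (OD F ×ˢ OD F) 1

/-- `N₀ ∈ O_D` is such that `η† N₀ η` generates, as an `O_F`-module, the image of `η† O_D η`
in `O_D / nrd(η) O_D`. -/
def IsGen (η N₀ : D F) : Prop :=
  N₀ ∈ OD F ∧ ∀ A ∈ OD F, ∃ c : F, ‖c‖ ≤ 1 ∧ ∃ B ∈ OD F,
    η.adjugate * A * η = c • (η.adjugate * N₀ * η) + η.det • B

/-- The set of `Z ∈ O_D` for which the image of `m M₀` in `(O_D / O_D η†)ⁿ` lies in
`Θ(O_Fⁿ, Z) = {l Z η† N₀ mod O_D η† : l ∈ O_Fⁿ}`. -/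
def thetaSet (η N₀ M₀ : D F) {n : ℕ} (m : Fin n → F) : Set (D F) :=
  {Z | Z ∈ OD F ∧ ∃ l : Fin n → F, (∀ i, ‖l i‖ ≤ 1) ∧
    ∀ i, ∃ A ∈ OD F, m i • M₀ = l i • (Z * η.adjugate * N₀) + A * η.adjugate}

/-- `𝒲(M₀, η)`: the supremum over primitive `m ∈ O_Fⁿ` of the measure of the set of `Z ∈ O_D`
with `m M₀ ∈ Θ(O_Fⁿ, Z)`. -/
def W [MeasurableSpace (D F)] (μ : Measure (D F)) (ϖ : F) (n : ℕ) (η N₀ M₀ : D F) : ℝ :=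
  ⨆ m : {m : Fin n → F // IsPrimitiveVec ϖ m}, μ.real (thetaSet η N₀ M₀ m.1)

/-- The congruence `γ' η ∈ m M₀ η + nrd(η) O_Dⁿ`. -/
def Cond {n : ℕ} (η : D F) (γ' : Fin n → D F) (M₀ : D F) (m : Fin n → F) : Prop :=
  ∀ i, ∃ B ∈ OD F, γ' i * η = m i • (M₀ * η) + η.det • B

end Field

end SplitPlace

end

/-! Since `ψ` is unramified, the indicator of `O_D` is its own Fourier transform for the trace
pairing. Expanding the condition `δ⁻¹P(Y) ∈ O_D` as an integral over `Z ∈ O_D` and applying Fubini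
turns `I0` into an integral over `Z` of a product of Gaussian integrals `gaussInt`, one for each `i`
because `P` is diagonal (`I0_eq_integral_prod_gaussInt`). With `δ = pη`, the Gaussian integrals have
quadratic part `υᵢ tr(AY²)/X` and linear part `tr(γ'ᵢY)/X`, where `A = Zη†` and `X = p det η`.

Polarization produces the self-adjoint map `Y ↦ AY + YA`; let `H` be its kernel modulo `X`, that is,
`anticommKer A X`. Translation by `H` multiplies the Gaussian integral by a character, so a nonzero
integral forces `γ'ᵢ` into the dual lattice, `γ'ᵢ = AY + YA + XB` (`exists_eq_anticomm_add_smul`).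
Differencing gives `|G|² ≤ vol H` (`norm_gaussInt_sq_le`), and `measure_anticommKer_le` bounds `vol
H` in terms of `|tr A|` and `‖A‖`.

The shape of `γ'ᵢ` does the rest. Because `Aη = det(η) Z`, it implies the congruence for `γ'η` and
confines `Z` to `thetaSet`. It also bounds `‖γ'‖` by `‖A‖` and `‖(γ' - γ'†)η‖` by `|tr A|`, up to
the floors `|X|` and `|det η|`, so the volume bound becomes one that is independent of `Z`. -/

noncomputable section

namespace SplitPlace

/-! ### The value group of `F` and the index of the maximal ideal. -/

section Measure

open scoped Pointwise ENNReal NNReal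

variable {F : Type*} [NontriviallyNormedField F]

instance [ProperSpace F] : SecondCountableTopology (D F) :=
  inferInstanceAs (SecondCountableTopology (Fin 2 → Fin 2 → F))

instance [ProperSpace F] : LocallyCompactSpace (D F) :=
  inferInstanceAs (LocallyCompactSpace (Fin 2 → Fin 2 → F))

lemma IsUniformizer.exists_norm_eq_zpow {ϖ : F} (h : IsUniformizer ϖ) {x : F} (hx : x ≠ 0) :
    ∃ k : ℤ, ‖x‖ = ‖ϖ‖ ^ k := by
  have h0 : 0 < ‖ϖ‖ := norm_pos_iff.2 h.1
  obtain ⟨k, hk1, hk2⟩ := exists_mem_Ioc_zpow (norm_pos_iff.2 hx)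
    ((one_lt_inv₀ h0).2 h.2.1)
  refine ⟨-(k + 1), ?_⟩
  rw [inv_zpow', neg_add] at hk2
  rw [inv_zpow'] at hk1
  have hn : ‖x * ϖ ^ (k + 1)‖ = ‖x‖ * ‖ϖ‖ ^ (k + 1) := by simp
  have hz : ‖ϖ‖ ^ (k + 1) * ‖ϖ‖ ^ (-(k + 1)) = 1 := by
    rw [← zpow_add₀ h0.ne']; simp
  have hp : 0 < ‖ϖ‖ ^ (k + 1) := zpow_pos h0 _
  have h1 : ‖x * ϖ ^ (k + 1)‖ ≤ 1 := by
    rw [hn, ← hz, mul_comm]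
    rw [neg_add]
    gcongr
  have h2 : ‖ϖ‖ < ‖x * ϖ ^ (k + 1)‖ := by
    rw [hn]
    calc ‖ϖ‖ = ‖ϖ‖ ^ (-k) * ‖ϖ‖ ^ (k + 1) := by rw [← zpow_add₀ h0.ne']; simp
      _ < _ := by gcongr
  have h3 : ‖x * ϖ ^ (k + 1)‖ = 1 := by
    refine le_antisymm h1 (not_lt.1 fun hlt => ?_)
    exact absurd (h.2.2 _ hlt) (not_le.2 h2)
  rw [hn, ← hz] at h3
  rw [mul_comm] at h3
  exact mul_left_cancel₀ hp.ne' h3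

variable [IsUltrametricDist F]

lemma norm_add_le_of {x y : F} {r : ℝ} (hx : ‖x‖ ≤ r) (hy : ‖y‖ ≤ r) : ‖x + y‖ ≤ r :=
  (IsUltrametricDist.norm_add_le_max x y).trans (max_le hx hy)

lemma norm_sub_le_of {x y : F} {r : ℝ} (hx : ‖x‖ ≤ r) (hy : ‖y‖ ≤ r) : ‖x - y‖ ≤ r := by
  rw [sub_eq_add_neg]; exact norm_add_le_of hx (by rwa [norm_neg])

/-- The unit ball is the disjoint union of the translates of `ϖ O_F` by representatives of the
residue field. -/
lemma residueCard_mul_measure_uniformizer_smul [MeasurableSpace F] [BorelSpace F]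
    (ν : Measure F) [ν.IsAddHaarMeasure] {ϖ : F} (h : IsUniformizer ϖ)
    (hq : residueCard F ≠ 0) :
    residueCard F * ν (ϖ • Metric.closedBall (0 : F) 1) = ν (Metric.closedBall 0 1) := by
  classical
  set O := (NormedField.valuation (K := F)).valuationSubring
  set k := IsLocalRing.ResidueField O
  have hfin : Finite k := Nat.finite_of_card_ne_zero hq
  have : Fintype k := Fintype.ofFinite k
  have hmem (x : F) : x ∈ O ↔ ‖x‖ ≤ 1 := by
    rw [Valuation.mem_valuationSubring_iff]
    exact Iff.rfl
  have hres (x y : O) : IsLocalRing.residue O x = IsLocalRing.residue O y ↔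
      ‖(x : F) - y‖ < 1 := by
    rw [← sub_eq_zero, ← map_sub, IsLocalRing.residue_eq_zero_iff, IsLocalRing.mem_maximalIdeal,
      mem_nonunits_iff]
    rw [show ((x : F) - y) = ((x - y : O) : F) from rfl]
    generalize x - y = z
    have hz := (hmem z).1 z.2
    rw [lt_iff_le_and_ne]
    constructor
    · refine fun hu => ⟨hz, fun h1 => hu ?_⟩
      have hz0 : (z : F) ≠ 0 := by
        intro h0; rw [h0] at h1; simp at h1
      refine IsUnit.of_mul_eq_one ⟨(z : F)⁻¹, (hmem _).2 (by simp [h1])⟩ ?_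
      ext
      simp [hz0]
    · rintro ⟨-, h1⟩ hu
      apply h1
      obtain ⟨w, hw⟩ := hu.exists_right_inv
      have hw' : ‖(z : F)‖ * ‖(w : F)‖ = 1 := by
        rw [← norm_mul, show (z : F) * w = ((z * w : O) : F) from rfl, hw]; simp
      have := (hmem w).1 w.2
      nlinarith [norm_nonneg (z : F), norm_nonneg (w : F)]
  have hball : ϖ • Metric.closedBall (0 : F) 1 = {x : F | ‖x‖ < 1} := by
    ext x
    rw [Set.mem_smul_set_iff_inv_smul_mem₀ h.1]
    simp only [smul_eq_mul, mem_closedBall_zero_iff, norm_mul, norm_inv, Set.mem_ofPred_eq]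
    have h0 : 0 < ‖ϖ‖ := norm_pos_iff.2 h.1
    rw [inv_mul_le_one₀ h0]
    exact ⟨fun hx => hx.trans_lt h.2.1, h.2.2 x⟩
  choose r hr using IsLocalRing.residue_surjective (R := O)
  have hunion : Metric.closedBall (0 : F) 1 =
      ⋃ a : k, (r a : F) +ᵥ (ϖ • Metric.closedBall (0 : F) 1) := by
    ext x
    simp only [mem_closedBall_zero_iff, Set.mem_iUnion, hball, Set.mem_vadd_set_iff_neg_vadd_mem,
      vadd_eq_add, Set.mem_ofPred_eq, neg_add_eq_sub]
    constructor
    · intro hx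
      refine ⟨IsLocalRing.residue O ⟨x, (hmem x).2 hx⟩, ?_⟩
      rw [← hres ⟨x, (hmem x).2 hx⟩, hr]
    · rintro ⟨a, ha⟩
      have := norm_add_le_of ha.le ((hmem _).1 (r a).2)
      simpa using this
  conv_rhs => rw [hunion]
  rw [measure_iUnion, tsum_fintype]
  · simp only [measure_vadd]
    simp [residueCard, k, O, Nat.card_eq_fintype_card]
  · intro a b hab
    rw [Function.onFun, Set.disjoint_left]
    simp only [hball, Set.mem_vadd_set_iff_neg_vadd_mem,
      vadd_eq_add, Set.mem_ofPred_eq, neg_add_eq_sub]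
    intro x hx1 hx2
    apply hab
    rw [← hr a, ← hr b, hres, norm_sub_rev]
    have := IsUltrametricDist.norm_add_le_max ((x : F) - r a) (r b - x)
    rw [norm_sub_rev (r b : F) x] at this
    have h3 := this.trans_lt (max_lt hx1 hx2)
    simpa using h3
  · intro a
    apply MeasurableSet.const_vadd
    rw [hball]
    exact (isOpen_lt continuous_norm continuous_const).measurableSet

end Measure

/-! ### The modulus of a linear automorphism of `Fⁿ` is `|det|`. -/

section Modulus

open scoped Pointwise ENNReal NNReal

variable {F : Type*} [NontriviallyNormedField F] [IsUltrametricDist F] [ProperSpace F]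

/-- The normalization of the absolute value enters here. A unit of `F` is a power of `ϖ` times an
element of norm one, and the latter preserves the unit ball. -/
lemma distribHaarChar_units {ϖ : F} (h : IsUniformizer ϖ)
    (hq : ‖ϖ‖ = ((residueCard F : ℝ))⁻¹) (u : Fˣ) : distribHaarChar F u = ‖(u : F)‖₊ := by
  borelize F
  let ν : Measure F := Measure.addHaar
  have h0 : 0 < ‖ϖ‖ := norm_pos_iff.2 h.1
  have hq0 : residueCard F ≠ 0 := by
    intro h0'; rw [h0'] at hq; simp at hq; exact h.1 hq
  have hb0 : ν (Metric.closedBall (0 : F) 1) ≠ 0 :=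
    (Metric.measure_closedBall_pos ν _ one_pos).ne'
  have hb : ν (Metric.closedBall (0 : F) 1) ≠ ∞ :=
    (isCompact_closedBall (0 : F) 1).measure_lt_top.ne
  have hϖ : distribHaarChar F (Units.mk0 ϖ h.1) = ‖ϖ‖₊ := by
    refine distribHaarChar_eq_of_measure_smul_eq_mul (μ := ν) hb0 hb ?_
    have h1 := residueCard_mul_measure_uniformizer_smul ν h hq0
    have h2 : (‖ϖ‖₊ : ℝ≥0) = (residueCard F : ℝ≥0)⁻¹ := by
      ext; simpa using hq
    rw [← h1, h2, ← mul_assoc, ENNReal.coe_inv (by exact_mod_cast hq0), ENNReal.coe_natCast,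
      ENNReal.inv_mul_cancel (by exact_mod_cast hq0) (by simp), one_mul]
    rfl
  obtain ⟨k, hk⟩ := h.exists_norm_eq_zpow u.ne_zero
  have hw : distribHaarChar F (u * (Units.mk0 ϖ h.1 ^ k)⁻¹) = 1 := by
    refine distribHaarChar_eq_of_measure_smul_eq_mul (μ := ν) hb0 hb ?_
    rw [ENNReal.coe_one, one_mul]
    congr 1
    ext x
    rw [Set.mem_smul_set_iff_inv_smul_mem]
    simp only [mem_closedBall_zero_iff, Units.smul_def, smul_eq_mul]
    have : ‖((u * (Units.mk0 ϖ h.1 ^ k)⁻¹)⁻¹ : Fˣ).val‖ = 1 := by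
      simp [hk, zpow_ne_zero k h0.ne']
    rw [norm_mul, this, one_mul]
  rw [map_mul, map_inv, map_zpow, hϖ, mul_inv_eq_one₀ (zpow_ne_zero _ (by simpa using h.1))] at hw
  rw [hw]
  ext
  simp [hk]

variable {ι : Type*} [Fintype ι] [DecidableEq ι]

instance : ContinuousConstSMul ((ι → F) ≃ₗ[F] (ι → F)) (ι → F) where
  continuous_const_smul e := LinearMap.continuous_of_finiteDimensional (e : (ι → F) →ₗ[F] (ι → F))

omit [IsUltrametricDist F] [ProperSpace F] in
lemma smul_pi_closedBall_of_diagonal {d : ι → F} (hd : ∀ i, d i ≠ 0)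
    (e : (ι → F) ≃ₗ[F] (ι → F))
    (he : (e : (ι → F) →ₗ[F] (ι → F)) = Matrix.toLin' (Matrix.diagonal d)) :
    e • (Set.univ.pi fun _ => Metric.closedBall (0 : F) 1) =
      Set.univ.pi fun i => Units.mk0 (d i) (hd i) • Metric.closedBall (0 : F) 1 := by
  have hex (y : ι → F) (i : ι) : e y i = d i * y i := by
    rw [← LinearEquiv.coe_coe, he]; simp [Matrix.mulVec_diagonal]
  ext x
  simp only [Set.mem_smul_set, Set.mem_univ_pi, Units.smul_def, smul_eq_mul, LinearEquiv.smul_def,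
    Units.val_mk0]
  constructor
  · rintro ⟨y, hy, rfl⟩ i
    exact ⟨y i, hy i, (hex y i).symm⟩
  · intro hx
    choose y hy hyx using hx
    exact ⟨y, hy, funext fun i => by rw [hex, hyx]⟩

lemma distribHaarChar_diagonal {ϖ : F} (h : IsUniformizer ϖ)
    (hq : ‖ϖ‖ = ((residueCard F : ℝ))⁻¹) {d : ι → F} (hd : ∀ i, d i ≠ 0)
    (e : (ι → F) ≃ₗ[F] (ι → F))
    (he : (e : (ι → F) →ₗ[F] (ι → F)) = Matrix.toLin' (Matrix.diagonal d)) :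
    distribHaarChar (ι → F) e = ‖(Matrix.diagonal d).det‖₊ := by
  borelize F
  let ν : Measure F := Measure.addHaar
  have hb0 : ν (Metric.closedBall (0 : F) 1) ≠ 0 :=
    (Metric.measure_closedBall_pos ν _ one_pos).ne'
  have hb : ν (Metric.closedBall (0 : F) 1) ≠ ∞ :=
    (isCompact_closedBall (0 : F) 1).measure_lt_top.ne
  refine distribHaarChar_eq_of_measure_smul_eq_mul (μ := Measure.pi fun _ : ι => ν)
    (s := Set.univ.pi fun _ => Metric.closedBall (0 : F) 1) ?_ ?_ ?_
  · rw [Measure.pi_pi]; exact Finset.prod_ne_zero_iff.2 fun _ _ => hb0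
  · rw [Measure.pi_pi]; exact ENNReal.prod_ne_top fun _ _ => hb
  · rw [smul_pi_closedBall_of_diagonal hd e he, Measure.pi_pi, Measure.pi_pi]
    simp_rw [← distribHaarChar_mul, distribHaarChar_units h hq]
    rw [Finset.prod_mul_distrib, Matrix.det_diagonal, nnnorm_prod]
    simp

omit [DecidableEq ι] in
lemma distribHaarChar_eq_one_of_smul_eq (e : (ι → F) ≃ₗ[F] (ι → F))
    (he : e • (Set.univ.pi fun _ : ι => Metric.closedBall (0 : F) 1) =
      Set.univ.pi fun _ => Metric.closedBall (0 : F) 1) :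
    distribHaarChar (ι → F) e = 1 := by
  borelize F
  let ν : Measure F := Measure.addHaar
  have hb0 : ν (Metric.closedBall (0 : F) 1) ≠ 0 :=
    (Metric.measure_closedBall_pos ν _ one_pos).ne'
  have hb : ν (Metric.closedBall (0 : F) 1) ≠ ∞ :=
    (isCompact_closedBall (0 : F) 1).measure_lt_top.ne
  refine distribHaarChar_eq_of_measure_smul_eq_mul (μ := Measure.pi fun _ : ι => ν)
    (s := Set.univ.pi fun _ => Metric.closedBall (0 : F) 1) ?_ ?_ ?_
  · rw [Measure.pi_pi]; exact Finset.prod_ne_zero_iff.2 fun _ _ => hb0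
  · rw [Measure.pi_pi]; exact ENNReal.prod_ne_top fun _ _ => hb
  · rw [he]; simp

omit [IsUltrametricDist F] [ProperSpace F] in
lemma transvection_mulVec (i j : ι) (c : F) (x : ι → F) :
    (Matrix.transvection i j c).mulVec x = Function.update x i (x i + c * x j) := by
  rw [Matrix.transvection, Matrix.add_mulVec, Matrix.one_mulVec, Matrix.single_mulVec_eq]
  ext k
  rcases eq_or_ne k i with rfl | hk
  · simp
  · simp [hk]

omit [IsUltrametricDist F] [ProperSpace F] in
lemma transvection_apply {i j : ι} (c : F) (e : (ι → F) ≃ₗ[F] (ι → F))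
    (he : (e : (ι → F) →ₗ[F] (ι → F)) = Matrix.toLin' (Matrix.transvection i j c)) (x : ι → F) :
    e x = Function.update x i (x i + c * x j) := by
  rw [← LinearEquiv.coe_coe, he, Matrix.toLin'_apply, transvection_mulVec]

lemma distribHaarChar_transvection_of_norm_le {i j : ι} (hij : i ≠ j) {c : F} (hc : ‖c‖ ≤ 1)
    (e : (ι → F) ≃ₗ[F] (ι → F))
    (he : (e : (ι → F) →ₗ[F] (ι → F)) = Matrix.toLin' (Matrix.transvection i j c)) :
    distribHaarChar (ι → F) e = 1 := by
  apply distribHaarChar_eq_one_of_smul_eq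
  have key {a : F} (ha : ‖a‖ ≤ 1) {x : ι → F} (hx : ∀ k, ‖x k‖ ≤ 1) (k : ι) :
      ‖Function.update x i (x i + a * x j) k‖ ≤ 1 := by
    rcases eq_or_ne k i with rfl | hk
    · simp only [Function.update_self]
      refine norm_add_le_of (hx _) ?_
      rw [norm_mul]
      exact mul_le_one₀ ha (norm_nonneg _) (hx _)
    · simpa [hk] using hx k
  ext x
  simp only [Set.mem_smul_set, Set.mem_univ_pi, LinearEquiv.smul_def, mem_closedBall_zero_iff]
  constructor
  · rintro ⟨y, hy, rfl⟩ k
    rw [transvection_apply c e he]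
    exact key hc hy k
  · intro hx
    refine ⟨_, key (a := -c) (by simpa using hc) hx, ?_⟩
    rw [transvection_apply c e he]
    ext k
    rcases eq_or_ne k i with rfl | hk
    · simp [hij.symm]
    · simp [hk]

/-- Scaling coordinate `i` by `ϖ ^ k` conjugates the transvection to one with coefficient `ϖ ^ k *
c`, integral for large `k`. A character with commutative target does not see the conjugation. -/
lemma distribHaarChar_transvection {ϖ : F} (h : IsUniformizer ϖ) {i j : ι} (hij : i ≠ j) (c : F)
    (e : (ι → F) ≃ₗ[F] (ι → F))
    (he : (e : (ι → F) →ₗ[F] (ι → F)) = Matrix.toLin' (Matrix.transvection i j c)) :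
    distribHaarChar (ι → F) e = 1 := by
  obtain ⟨k, hk⟩ : ∃ k : ℕ, ‖ϖ ^ k * c‖ ≤ 1 := by
    have := (tendsto_pow_atTop_nhds_zero_of_lt_one (norm_nonneg ϖ) h.2.1).mul_const ‖c‖
    rw [zero_mul] at this
    obtain ⟨k, hk⟩ := (this.eventually_le_const one_pos).exists
    exact ⟨k, by simpa using hk⟩
  have ht : ϖ ^ k ≠ 0 := pow_ne_zero _ h.1
  set d : ι → F := Function.update 1 i (ϖ ^ k)
  have hd (l : ι) : d l ≠ 0 := by
    rcases eq_or_ne l i with rfl | hl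
    · simpa [d] using ht
    · simp [d, hl]
  let s : (ι → F) ≃ₗ[F] (ι → F) := LinearEquiv.piCongrRight fun l =>
    LinearEquiv.smulOfNeZero F F (d l) (hd l)
  have hs (x : ι → F) (l : ι) : s x l = d l * x l := rfl
  have hconj : distribHaarChar (ι → F) (s * e * s⁻¹) = distribHaarChar (ι → F) e := by
    rw [map_mul, map_mul, map_inv, mul_comm, ← mul_assoc, inv_mul_cancel₀
      distribHaarChar_pos.ne', one_mul]
  rw [← hconj]
  refine distribHaarChar_transvection_of_norm_le hij hk _ ?_
  apply LinearMap.ext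
  intro x
  obtain ⟨y, rfl⟩ := s.surjective x
  have h1 : (s * e * s⁻¹) (s y) = s (e y) := by
    rw [mul_assoc, LinearEquiv.mul_apply, LinearEquiv.mul_apply]
    congr 2
    exact s.symm_apply_apply y
  rw [LinearEquiv.coe_coe, h1, transvection_apply c e he, Matrix.toLin'_apply, transvection_mulVec]
  ext l
  rcases eq_or_ne l i with rfl | hl
  · simp [hs, d, hij.symm]
    ring
  · simp [hs, d, hl]

/-- Both sides are multiplicative, so Gaussian elimination reduces to diagonal matrices and
transvections. -/
theorem distribHaarChar_linearEquiv {ϖ : F} (h : IsUniformizer ϖ)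
    (hq : ‖ϖ‖ = ((residueCard F : ℝ))⁻¹) {A : Matrix ι ι F} (hA : A.det ≠ 0)
    (e : (ι → F) ≃ₗ[F] (ι → F)) (he : (e : (ι → F) →ₗ[F] (ι → F)) = Matrix.toLin' A) :
    distribHaarChar (ι → F) e = ‖A.det‖₊ := by
  revert e
  refine Matrix.diagonal_transvection_induction_of_det_ne_zero
    (fun A => ∀ e : (ι → F) ≃ₗ[F] (ι → F), (e : (ι → F) →ₗ[F] (ι → F)) = Matrix.toLin' A →
      distribHaarChar (ι → F) e = ‖A.det‖₊) A hA ?_ ?_ ?_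
  · intro d hd e he
    rw [Matrix.det_diagonal, Finset.prod_ne_zero_iff] at hd
    exact distribHaarChar_diagonal h hq (fun i => hd i (Finset.mem_univ i)) e he
  · rintro ⟨i, j, hij, c⟩ e he
    rw [distribHaarChar_transvection h hij c e he]
    simp [Matrix.TransvectionStruct.toMatrix, hij]
  · intro A B hA hB ihA ihB e he
    let eA := LinearEquiv.ofIsUnitDet (f := Matrix.toLin' A) (v := Pi.basisFun F ι)
      (v' := Pi.basisFun F ι) (by simpa [LinearMap.toMatrix_eq_toMatrix'] using hA)
    let eB := LinearEquiv.ofIsUnitDet (f := Matrix.toLin' B) (v := Pi.basisFun F ι)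
      (v' := Pi.basisFun F ι) (by simpa [LinearMap.toMatrix_eq_toMatrix'] using hB)
    have hAB : e = eA * eB := by
      apply LinearEquiv.toLinearMap_injective
      rw [he, Matrix.toLin'_mul]
      rfl
    rw [hAB, map_mul, ihA eA rfl, ihB eB rfl, Matrix.det_mul, nnnorm_mul]

/-- The set of integral vectors with integral image under `A` has volume at most `|det A|⁻¹`. -/
theorem measure_mulVec_le {ϖ : F} (h : IsUniformizer ϖ)
    (hq : ‖ϖ‖ = ((residueCard F : ℝ))⁻¹) [MeasurableSpace F] [BorelSpace F]
    (ν : Measure (ι → F)) [ν.IsAddHaarMeasure] {A : Matrix ι ι F} (hA : A.det ≠ 0)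
    (S : Set (ι → F)) (hS : ∀ x ∈ S, ∀ i, ‖A.mulVec x i‖ ≤ 1) :
    ‖A.det‖₊ * ν S ≤ ν (Set.univ.pi fun _ => Metric.closedBall (0 : F) 1) := by
  let e := LinearEquiv.ofIsUnitDet (f := Matrix.toLin' A) (v := Pi.basisFun F ι)
      (v' := Pi.basisFun F ι) (by simpa [LinearMap.toMatrix_eq_toMatrix'] using hA)
  rw [← distribHaarChar_linearEquiv h hq hA e rfl, distribHaarChar_mul]
  refine measure_mono ?_
  rintro _ ⟨x, hx, rfl⟩ i -
  rw [mem_closedBall_zero_iff]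
  exact hS x hx i

end Modulus

/-! ### Volume bounds for `anticommKer` from integral linear forms. -/

section Volume

open scoped Pointwise ENNReal NNReal

variable {F : Type*} [NontriviallyNormedField F]

lemma boxNorm_le_iff {x : D F} {r : ℝ} (hr : 0 ≤ r) : boxNorm x ≤ r ↔ ∀ i j, ‖x i j‖ ≤ r := by
  rw [boxNorm, pi_norm_le_iff_of_nonneg hr]
  exact ⟨fun h i j => h (i, j), fun h p => h p.1 p.2⟩

lemma norm_le_boxNorm (x : D F) (i j : Fin 2) : ‖x i j‖ ≤ boxNorm x :=
  norm_le_pi_norm (fun p : Fin 2 × Fin 2 => x p.1 p.2) (i, j)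

lemma boxNorm_nonneg (x : D F) : 0 ≤ boxNorm x := norm_nonneg _

/-- The entries of a matrix in `D`, as a vector. -/
def entries (F : Type*) [NontriviallyNormedField F] : D F ≃ₗ[F] (Fin 4 → F) where
  toFun Y := ![Y 0 0, Y 0 1, Y 1 0, Y 1 1]
  invFun v := !![v 0, v 1; v 2, v 3]
  left_inv Y := by ext i j; fin_cases i <;> fin_cases j <;> rfl
  right_inv v := by ext i; fin_cases i <;> rfl
  map_add' Y Z := by ext i; fin_cases i <;> rfl
  map_smul' c Y := by ext i; fin_cases i <;> rfl

lemma entries_apply (Y : D F) : entries F Y = ![Y 0 0, Y 0 1, Y 1 0, Y 1 1] := rfl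

lemma mem_OD_iff_entries (Y : D F) :
    Y ∈ OD F ↔ entries F Y ∈ Set.univ.pi fun _ => Metric.closedBall (0 : F) 1 := by
  simp only [OD, Set.mem_ofPred_eq, Set.mem_univ_pi, mem_closedBall_zero_iff, entries_apply,
    Fin.forall_fin_succ]
  simp [and_assoc]

variable [ProperSpace F]

lemma continuous_of_linear {V W : Type*} [AddCommGroup V] [Module F V] [TopologicalSpace V]
    [IsTopologicalAddGroup V] [ContinuousSMul F V] [T2Space V] [FiniteDimensional F V]
    [AddCommGroup W] [Module F W] [TopologicalSpace W] [IsTopologicalAddGroup W]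
    [ContinuousSMul F W] (f : V →ₗ[F] W) : Continuous f :=
  LinearMap.continuous_of_finiteDimensional f

lemma isCompact_OD : IsCompact (OD F) := by
  have h : OD F = Set.univ.pi fun _ : Fin 2 => Set.univ.pi fun _ : Fin 2 =>
      Metric.closedBall (0 : F) 1 := by
    ext Y
    exact ⟨fun hY a _ b _ => by simpa using hY a b, fun hY a b => by
      simpa using hY a trivial b trivial⟩
  rw [h]
  exact isCompact_univ_pi fun _ => isCompact_univ_pi fun _ => isCompact_closedBall _ _

variable [MeasurableSpace (D F)] [BorelSpace (D F)]

lemma measurableSet_OD : MeasurableSet (OD F) := isCompact_OD.isClosed.measurableSet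

/-- Additive automorphisms of `D` that preserve `O_D` preserve the Haar measure. -/
lemma measure_preimage_of_preimage_OD (μ : Measure (D F)) [μ.IsAddHaarMeasure]
    (hμ : μ (OD F) = 1) (φ : D F ≃ₗ[F] D F) (hφ : ∀ Y, φ Y ∈ OD F ↔ Y ∈ OD F) (S : Set (D F)) :
    μ (φ ⁻¹' S) = μ S := by
  let ψ : D F ≃ₜ+ D F :=
    { φ.toAddEquiv with
      continuous_toFun := continuous_of_linear (φ : D F →ₗ[F] D F)
      continuous_invFun := continuous_of_linear (φ.symm : D F →ₗ[F] D F) }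
  have hS (S : Set (D F)) : ψ ⁻¹' S = φ ⁻¹' S := rfl
  have h1 := addEquivAddHaarChar_smul_preimage μ (X := OD F) ψ
  have h2 : φ ⁻¹' (OD F) = OD F := Set.ext hφ
  rw [hS, h2, hμ] at h1
  have h3 : addEquivAddHaarChar ψ = 1 := by
    rw [ENNReal.smul_def, smul_eq_mul, mul_one] at h1
    exact_mod_cast h1
  have h4 := addEquivAddHaarChar_smul_preimage μ (X := S) ψ
  rwa [h3, one_smul, hS] at h4

variable [IsUltrametricDist F]

/-- Four linear forms that are integral on `S` bound its volume. The product form keeps the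
statement meaningful when the forms are dependent. -/
lemma norm_det_mul_measure_le {ϖ : F} (h : IsUniformizer ϖ)
    (hq : ‖ϖ‖ = ((residueCard F : ℝ))⁻¹) (μ : Measure (D F)) [μ.IsAddHaarMeasure]
    (hμ : μ (OD F) = 1) (B : Matrix (Fin 4) (Fin 4) F) {S : Set (D F)}
    (hS : ∀ Y ∈ S, ∀ i, ‖B.mulVec (entries F Y) i‖ ≤ 1) :
    μ.real S * ‖B.det‖ ≤ 1 := by
  by_cases hB : B.det = 0
  · rw [hB]; simp
  borelize F
  let e : D F ≃L[F] (Fin 4 → F) :=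
    { entries F with
      continuous_toFun := continuous_of_linear (entries F : D F →ₗ[F] (Fin 4 → F))
      continuous_invFun := continuous_of_linear ((entries F).symm : (Fin 4 → F) →ₗ[F] D F) }
  have : (μ.map e).IsAddHaarMeasure := e.isAddHaarMeasure_map μ
  have hmap (T : Set (Fin 4 → F)) : μ.map e T = μ (e ⁻¹' T) :=
    e.toHomeomorph.toMeasurableEquiv.map_apply T
  have h1 := measure_mulVec_le h hq (μ.map e) hB (e '' S) (by
    rintro _ ⟨Y, hY, rfl⟩
    exact hS Y hY)
  have h2 : e ⁻¹' (Set.univ.pi fun _ => Metric.closedBall (0 : F) 1) = OD F :=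
    Set.ext fun Y => (mem_OD_iff_entries Y).symm
  rw [hmap, hmap, Set.preimage_image_eq _ e.injective, h2, hμ] at h1
  have h3 := ENNReal.toReal_mono ENNReal.one_ne_top h1
  rw [ENNReal.toReal_mul] at h3
  rw [mul_comm]
  simpa [Measure.real] using h3

/-- The kernel in `O_D` of `Y ↦ A Y + Y A` modulo `X O_D`. -/
def anticommKer (A : D F) (X : F) : Set (D F) :=
  {Y | Y ∈ OD F ∧ ∀ i j, ‖(A * Y + Y * A) i j‖ ≤ ‖X‖}

omit [ProperSpace F] [MeasurableSpace (D F)] [BorelSpace (D F)] [IsUltrametricDist F] in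
lemma norm_div_le_one {x X : F} (h : ‖x‖ ≤ ‖X‖) : ‖x / X‖ ≤ 1 := by
  rw [norm_div]
  exact div_le_one_of_le₀ h (norm_nonneg _)

section Bounds

variable {ϖ : F} (h : IsUniformizer ϖ)
  (hq : ‖ϖ‖ = ((residueCard F : ℝ))⁻¹) (μ : Measure (D F)) [μ.IsAddHaarMeasure]
  (hμ : μ (OD F) = 1) (h2 : ‖(2 : F)‖ = 1) {X : F} (hX : X ≠ 0) (A : D F)
include h hq hμ h2 hX

/-- The forms are two entries of `Y` and, divided by `X`, the `(0,1)` entry and the trace of `AY +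
YA`; their determinant is `2 a₀₁² / X²` up to sign. -/
lemma measure_anticommKer_mul_sq_le :
    μ.real (anticommKer A X) * ‖A 0 1‖ ^ 2 ≤ ‖X‖ ^ 2 := by
  have h1 := norm_det_mul_measure_le h hq μ hμ (S := anticommKer A X)
    !![0, 1, 0, 0;
       A 0 1 / X, A.trace / X, 0, A 0 1 / X;
       1, 0, 0, 0;
       2 * A 0 0 / X, 2 * A 1 0 / X, 2 * A 0 1 / X, 2 * A 1 1 / X] (by
    rintro Y ⟨hY, hAY⟩ i
    have e01 := norm_div_le_one (hAY 0 1)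
    have et := norm_div_le_one (norm_add_le_of (hAY 0 0) (hAY 1 1))
    simp only [Matrix.add_apply, Matrix.mul_apply, Fin.sum_univ_two] at e01 et
    fin_cases i
    · simpa [Matrix.mulVec, dotProduct, Fin.sum_univ_succ, entries_apply] using hY 0 1
    · convert e01 using 2
      simp [Matrix.mulVec, dotProduct, Fin.sum_univ_succ, entries_apply, Matrix.trace]
      ring
    · simpa [Matrix.mulVec, dotProduct, Fin.sum_univ_succ, entries_apply] using hY 0 0
    · convert et using 2
      simp [Matrix.mulVec, dotProduct, Fin.sum_univ_succ, entries_apply]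
      ring)
  have hdet : ‖(!![0, 1, 0, 0;
       A 0 1 / X, A.trace / X, 0, A 0 1 / X;
       1, 0, 0, 0;
       2 * A 0 0 / X, 2 * A 1 0 / X, 2 * A 0 1 / X, 2 * A 1 1 / X] :
       Matrix (Fin 4) (Fin 4) F).det‖ = ‖A 0 1‖ ^ 2 / ‖X‖ ^ 2 := by
    have : ‖(2 : F) * A 0 1 ^ 2 / X ^ 2‖ = ‖A 0 1‖ ^ 2 / ‖X‖ ^ 2 := by simp [h2]
    rw [← this]
    first
    | (congr 1
       simp [Matrix.det_succ_row_zero, Fin.sum_univ_succ, Fin.succAbove]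
       ring; done)
    | (rw [← norm_neg]; congr 1
       simp [Matrix.det_succ_row_zero, Fin.sum_univ_succ, Fin.succAbove]
       ring)
  rw [hdet, ← mul_div_assoc, div_le_one (by positivity)] at h1
  exact h1

/-- Replacing the form `Y 0 0` by the difference of the diagonal entries of `AY + YA`, divided by
`X`, gains a factor `tr A / X` in the determinant. -/
lemma measure_anticommKer_mul_sq_mul_trace_le :
    μ.real (anticommKer A X) * (‖A 0 1‖ ^ 2 * ‖A.trace‖) ≤ ‖X‖ ^ 3 := by
  have h1 := norm_det_mul_measure_le h hq μ hμ (S := anticommKer A X)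
    !![0, 1, 0, 0;
       A 0 1 / X, A.trace / X, 0, A 0 1 / X;
       2 * A 0 0 / X, 0, 0, - 2 * A 1 1 / X;
       2 * A 0 0 / X, 2 * A 1 0 / X, 2 * A 0 1 / X, 2 * A 1 1 / X] (by
    rintro Y ⟨hY, hAY⟩ i
    have e01 := norm_div_le_one (hAY 0 1)
    have et := norm_div_le_one (norm_add_le_of (hAY 0 0) (hAY 1 1))
    have es := norm_div_le_one (norm_sub_le_of (hAY 0 0) (hAY 1 1))
    simp only [Matrix.add_apply, Matrix.mul_apply, Fin.sum_univ_two] at e01 et es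
    fin_cases i
    · simpa [Matrix.mulVec, dotProduct, Fin.sum_univ_succ, entries_apply] using hY 0 1
    · convert e01 using 2
      simp [Matrix.mulVec, dotProduct, Fin.sum_univ_succ, entries_apply, Matrix.trace]
      ring
    · convert es using 2
      simp [Matrix.mulVec, dotProduct, Fin.sum_univ_succ, entries_apply]
      ring
    · convert et using 2
      simp [Matrix.mulVec, dotProduct, Fin.sum_univ_succ, entries_apply]
      ring)
  have hdet : ‖(!![0, 1, 0, 0;
       A 0 1 / X, A.trace / X, 0, A 0 1 / X;
       2 * A 0 0 / X, 0, 0, - 2 * A 1 1 / X;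
       2 * A 0 0 / X, 2 * A 1 0 / X, 2 * A 0 1 / X, 2 * A 1 1 / X] :
       Matrix (Fin 4) (Fin 4) F).det‖ = ‖A 0 1‖ ^ 2 * ‖A.trace‖ / ‖X‖ ^ 3 := by
    have : ‖(2 : F) * 2 * A 0 1 ^ 2 * A.trace / X ^ 3‖ = ‖A 0 1‖ ^ 2 * ‖A.trace‖ / ‖X‖ ^ 3 := by
      simp [h2]
    rw [← this]
    first
    | (congr 1
       simp [Matrix.det_succ_row_zero, Fin.sum_univ_succ, Fin.succAbove, Matrix.trace]
       ring; done)
    | (rw [← norm_neg]; congr 1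
       simp [Matrix.det_succ_row_zero, Fin.sum_univ_succ, Fin.succAbove, Matrix.trace]
       ring)
  rw [hdet, ← mul_div_assoc, div_le_one (by positivity)] at h1
  exact h1

/-- For dominant trace, the forms are `tr Y` and the three traceless coordinates of `AY + YA`
divided by `X`. -/
lemma measure_anticommKer_mul_trace_le :
    μ.real (anticommKer A X) * ‖A.trace‖ ^ 3 ≤ ‖X‖ ^ 3 := by
  have h1 := norm_det_mul_measure_le h hq μ hμ (S := anticommKer A X)
    !![1, 0, 0, 1;
       A 0 1 / X, A.trace / X, 0, A 0 1 / X;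
       A 1 0 / X, 0, A.trace / X, A 1 0 / X;
       2 * A 0 0 / X, 0, 0, - 2 * A 1 1 / X] (by
    rintro Y ⟨hY, hAY⟩ i
    have e01 := norm_div_le_one (hAY 0 1)
    have e10 := norm_div_le_one (hAY 1 0)
    have es := norm_div_le_one (norm_sub_le_of (hAY 0 0) (hAY 1 1))
    simp only [Matrix.add_apply, Matrix.mul_apply, Fin.sum_univ_two] at e01 e10 es
    fin_cases i
    · simpa [Matrix.mulVec, dotProduct, Fin.sum_univ_succ, entries_apply] using
        norm_add_le_of (hY 0 0) (hY 1 1)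
    · convert e01 using 2
      simp [Matrix.mulVec, dotProduct, Fin.sum_univ_succ, entries_apply, Matrix.trace]
      ring
    · convert e10 using 2
      simp [Matrix.mulVec, dotProduct, Fin.sum_univ_succ, entries_apply, Matrix.trace]
      ring
    · convert es using 2
      simp [Matrix.mulVec, dotProduct, Fin.sum_univ_succ, entries_apply]
      ring)
  have hdet : ‖(!![1, 0, 0, 1;
       A 0 1 / X, A.trace / X, 0, A 0 1 / X;
       A 1 0 / X, 0, A.trace / X, A 1 0 / X;
       2 * A 0 0 / X, 0, 0, - 2 * A 1 1 / X] :
       Matrix (Fin 4) (Fin 4) F).det‖ = ‖A.trace‖ ^ 3 / ‖X‖ ^ 3 := by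
    have : ‖(2 : F) * A.trace ^ 3 / X ^ 3‖ = ‖A.trace‖ ^ 3 / ‖X‖ ^ 3 := by
      simp [h2]
    rw [← this]
    first
    | (congr 1
       simp [Matrix.det_succ_row_zero, Fin.sum_univ_succ, Fin.succAbove, Matrix.trace]
       ring; done)
    | (rw [← norm_neg]; congr 1
       simp [Matrix.det_succ_row_zero, Fin.sum_univ_succ, Fin.succAbove, Matrix.trace]
       ring)
  rw [hdet, ← mul_div_assoc, div_le_one (by positivity)] at h1
  exact h1

end Bounds

end Volume

/-! ### Arithmetic of the maximal order. -/

section Order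

variable {F : Type*} [NontriviallyNormedField F] [IsUltrametricDist F]

lemma add_mem_OD {A B : D F} (hA : A ∈ OD F) (hB : B ∈ OD F) : A + B ∈ OD F :=
  fun i j => norm_add_le_of (hA i j) (hB i j)

omit [IsUltrametricDist F] in
lemma neg_mem_OD {A : D F} (hA : A ∈ OD F) : -A ∈ OD F :=
  fun i j => by simpa using hA i j

lemma sub_mem_OD {A B : D F} (hA : A ∈ OD F) (hB : B ∈ OD F) : A - B ∈ OD F :=
  fun i j => norm_sub_le_of (hA i j) (hB i j)

omit [IsUltrametricDist F] in
lemma zero_mem_OD : (0 : D F) ∈ OD F := fun i j => by simp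

omit [IsUltrametricDist F] in
lemma smul_mem_OD {c : F} (hc : ‖c‖ ≤ 1) {A : D F} (hA : A ∈ OD F) : c • A ∈ OD F :=
  fun i j => by
    rw [Matrix.smul_apply, smul_eq_mul, norm_mul]
    exact mul_le_one₀ hc (norm_nonneg _) (hA i j)

lemma norm_mul_apply_le {A B : D F} {r s : ℝ} (hA : ∀ i j, ‖A i j‖ ≤ r)
    (hB : ∀ i j, ‖B i j‖ ≤ s) (i j : Fin 2) : ‖(A * B) i j‖ ≤ r * s := by
  have hr : 0 ≤ r := (norm_nonneg _).trans (hA 0 0)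
  rw [Matrix.mul_apply, Fin.sum_univ_two]
  refine norm_add_le_of ?_ ?_ <;> rw [norm_mul] <;>
  exact mul_le_mul (hA _ _) (hB _ _) (norm_nonneg _) hr

lemma mul_mem_OD {A B : D F} (hA : A ∈ OD F) (hB : B ∈ OD F) : A * B ∈ OD F :=
  fun i j => by simpa using norm_mul_apply_le hA hB i j

omit [IsUltrametricDist F] in
lemma adjugate_mem_OD {A : D F} (hA : A ∈ OD F) : A.adjugate ∈ OD F := by
  intro i j
  rw [Matrix.adjugate_fin_two]
  fin_cases i <;> fin_cases j <;> simp [hA 0 0, hA 0 1, hA 1 0, hA 1 1]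

lemma norm_trace_le {A : D F} {r : ℝ} (hA : ∀ i j, ‖A i j‖ ≤ r) : ‖A.trace‖ ≤ r := by
  rw [Matrix.trace_fin_two]
  exact norm_add_le_of (hA 0 0) (hA 1 1)

lemma norm_det_le_one {A : D F} (hA : A ∈ OD F) : ‖A.det‖ ≤ 1 := by
  rw [Matrix.det_fin_two]
  apply norm_sub_le_of <;> rw [norm_mul] <;>
  exact mul_le_one₀ (hA _ _) (norm_nonneg _) (hA _ _)

omit [IsUltrametricDist F] in
lemma exists_mem_OD_eq_smul {A : D F} {X : F} (hX : X ≠ 0) (h : ∀ i j, ‖A i j‖ ≤ ‖X‖) :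
    ∃ B ∈ OD F, A = X • B := by
  refine ⟨X⁻¹ • A, fun i j => ?_, by rw [smul_smul, mul_inv_cancel₀ hX, one_smul]⟩
  rw [Matrix.smul_apply, smul_eq_mul, mul_comm, ← div_eq_mul_inv]
  exact norm_div_le_one (h i j)

omit [IsUltrametricDist F] in
/-- Integrality can be tested by the trace pairing. -/
lemma mem_OD_of_norm_trace_mul_le {A : D F} (h : ∀ B ∈ OD F, ‖(A * B).trace‖ ≤ 1) :
    A ∈ OD F := by
  intro i j
  have := h (Matrix.single j i 1) (fun a b => by
    rw [Matrix.single_apply]; split_ifs <;> simp)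
  simpa [Matrix.trace_mul_single] using this

end Order

/-! ### Integral conjugation and the full volume bound. -/

section Conjugation

variable {F : Type*} [NontriviallyNormedField F] [IsUltrametricDist F]

/-- Conjugation by an invertible matrix. -/
def conjEquiv {k k' : D F} (h1 : k * k' = 1) (h2 : k' * k = 1) : D F ≃ₗ[F] D F where
  toFun Y := k * Y * k'
  invFun Y := k' * Y * k
  left_inv Y := by
    simp only [← mul_assoc, h2, one_mul]; rw [mul_assoc, h2, mul_one]
  right_inv Y := by
    simp only [← mul_assoc, h1, one_mul]; rw [mul_assoc, h1, mul_one]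
  map_add' Y Z := by rw [mul_add, add_mul]
  map_smul' c Y := by simp

/-- Some integral conjugate has an upper right entry of the size of the traceless part. -/
lemma exists_conj_norm_le (A : D F) :
    ∃ k ∈ OD F, ∃ k' ∈ OD F, k * k' = 1 ∧ k' * k = 1 ∧
      ‖A 0 1‖ ≤ ‖(k * A * k') 0 1‖ ∧ ‖A 1 0‖ ≤ ‖(k * A * k') 0 1‖ ∧
      ‖A 0 0 - A 1 1‖ ≤ ‖(k * A * k') 0 1‖ := by
  by_cases hb : ‖A 1 0‖ ≤ ‖A 0 1‖ ∧ ‖A 0 0 - A 1 1‖ ≤ ‖A 0 1‖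
  · have h1 : (1 : D F) ∈ OD F := fun i j => by
      fin_cases i <;> fin_cases j <;> simp
    exact ⟨1, h1, 1, h1, by simp, by simp, by simpa using hb⟩
  by_cases hc : ‖A 0 1‖ ≤ ‖A 1 0‖ ∧ ‖A 0 0 - A 1 1‖ ≤ ‖A 1 0‖
  · have h1 : (!![0, 1; 1, 0] : D F) ∈ OD F := fun i j => by
      fin_cases i <;> fin_cases j <;> simp
    have h3 : (!![0, 1; 1, 0] * !![0, 1; 1, 0] : D F) = 1 := by
      ext i j; fin_cases i <;> fin_cases j <;> simp
    refine ⟨_, h1, _, h1, h3, h3, ?_⟩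
    have : (!![0, 1; 1, 0] * A * !![0, 1; 1, 0] : D F) 0 1 = A 1 0 := by
      simp [Matrix.mul_apply, Matrix.vecMul, dotProduct, Fin.sum_univ_two]
    rw [this]
    exact ⟨hc.1, le_rfl, hc.2⟩
  have hs : ‖A 0 1‖ < ‖A 0 0 - A 1 1‖ ∧ ‖A 1 0‖ < ‖A 0 0 - A 1 1‖ := by
    rw [not_and_or, not_le, not_le] at hb hc
    rcases hb with hb | hb <;> rcases hc with hc | hc <;> constructor <;> linarith
  -- The diagonal difference now strictly dominates both off-diagonal entries, and a unipotent
  -- conjugation moves it into the `(0,1)` place.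
  refine ⟨!![1, 1; 0, 1], fun i j => ?_, !![1, -1; 0, 1], fun i j => ?_, ?_, ?_, ?_⟩
  · fin_cases i <;> fin_cases j <;> simp
  · fin_cases i <;> fin_cases j <;> simp
  · ext i j; fin_cases i <;> fin_cases j <;> simp
  · ext i j; fin_cases i <;> fin_cases j <;> simp
  have he : (!![1, 1; 0, 1] * A * !![1, -1; 0, 1] : D F) 0 1 =
      (A 0 1 - A 1 0) - (A 0 0 - A 1 1) := by
    simp [Matrix.mul_apply, Matrix.vecMul, dotProduct, Fin.sum_univ_two]
    ring
  have hlt : ‖A 0 1 - A 1 0‖ < ‖A 0 0 - A 1 1‖ := by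
    refine lt_of_le_of_lt (norm_sub_le_of (le_max_left _ _) (le_max_right _ _)) (max_lt hs.1 hs.2)
  have hn : ‖(A 0 1 - A 1 0) - (A 0 0 - A 1 1)‖ = ‖A 0 0 - A 1 1‖ := by
    have := IsUltrametricDist.norm_add_eq_max_of_norm_ne_norm
      (x := A 0 1 - A 1 0) (y := -(A 0 0 - A 1 1)) (by rw [norm_neg]; exact hlt.ne)
    rw [norm_neg, max_eq_right hlt.le, ← sub_eq_add_neg] at this
    exact this
  rw [he, hn]
  exact ⟨hs.1.le, hs.2.le, le_rfl⟩

lemma conj_mem_anticommKer {A k k' : D F} (hk : k ∈ OD F) (hk' : k' ∈ OD F)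
    (h2 : k' * k = 1) {X : F} {Y : D F} (hY : Y ∈ anticommKer A X) :
    k * Y * k' ∈ anticommKer (k * A * k') X := by
  refine ⟨mul_mem_OD (mul_mem_OD hk hY.1) hk', fun i j => ?_⟩
  have h3 (U V : D F) : k * U * k' * (k * V * k') = k * (U * V) * k' := by
    calc k * U * k' * (k * V * k') = k * U * (k' * k) * V * k' := by noncomm_ring
      _ = _ := by rw [h2]; noncomm_ring
  rw [h3, h3, ← add_mul, ← mul_add]
  simpa using norm_mul_apply_le (norm_mul_apply_le hk hY.2) hk' i j

variable [ProperSpace F] [MeasurableSpace (D F)] [BorelSpace (D F)]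

lemma measure_anticommKer_le_conj (μ : Measure (D F)) [μ.IsAddHaarMeasure]
    (hμ : μ (OD F) = 1) (A : D F) (X : F) {k k' : D F} (hk : k ∈ OD F) (hk' : k' ∈ OD F)
    (h1 : k * k' = 1) (h2 : k' * k = 1) :
    μ.real (anticommKer A X) ≤ μ.real (anticommKer (k * A * k') X) := by
  have hpre := measure_preimage_of_preimage_OD μ hμ (conjEquiv h1 h2) (fun Y => by
    refine ⟨fun hY => ?_, fun hY => mul_mem_OD (mul_mem_OD hk hY) hk'⟩
    have := mul_mem_OD (mul_mem_OD hk' hY) hk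
    rwa [show k' * (conjEquiv h1 h2) Y * k = Y from (conjEquiv h1 h2).left_inv Y] at this)
    (anticommKer (k * A * k') X)
  rw [Measure.real, Measure.real, ← hpre]
  refine ENNReal.toReal_mono ?_ (measure_mono fun Y hY => conj_mem_anticommKer hk hk' h2 hY)
  rw [hpre]
  exact ((measure_mono fun Y hY => hY.1).trans_lt (hμ ▸ ENNReal.one_lt_top)).ne

omit [IsUltrametricDist F] [ProperSpace F] [BorelSpace (D F)] in
lemma measure_anticommKer_le_one (μ : Measure (D F))
    (hμ : μ (OD F) = 1) (A : D F) (X : F) : μ.real (anticommKer A X) ≤ 1 := by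
  have : μ (anticommKer A X) ≤ 1 := hμ ▸ measure_mono fun Y hY => hY.1
  simpa [Measure.real] using ENNReal.toReal_mono ENNReal.one_ne_top this

/-- After conjugation the `(0,1)` entry controls the traceless part; as 2 is a unit, `‖A‖` is at
most the larger of `|tr A|` and that entry. Each case is covered by the determinant bounds. The
parameter `r` allows `|tr A|` to be compared with `|det η|` while the kernel is taken modulo `p det
η`. -/
theorem measure_anticommKer_le {ϖ : F} (h : IsUniformizer ϖ)
    (hq : ‖ϖ‖ = ((residueCard F : ℝ))⁻¹) (μ : Measure (D F)) [μ.IsAddHaarMeasure]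
    (hμ : μ (OD F) = 1) (h2 : ‖(2 : F)‖ = 1) {X : F} (hX : X ≠ 0) {r : ℝ} (hr : ‖X‖ ≤ r)
    (A : D F) :
    μ.real (anticommKer A X) * (max ‖A.trace‖ r * max (boxNorm A) ‖X‖ ^ 2) ≤ r * ‖X‖ ^ 2 := by
  set m := μ.real (anticommKer A X)
  have hm1 : m ≤ 1 := measure_anticommKer_le_one μ hμ A X
  have hm0 : 0 ≤ m := measureReal_nonneg
  have hX0 : 0 < ‖X‖ := norm_pos_iff.2 hX
  have hr0 : 0 < r := hX0.trans_le hr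
  have htr : ‖A.trace‖ ≤ boxNorm A := norm_trace_le (norm_le_boxNorm A)
  rcases le_or_gt (boxNorm A) ‖X‖ with hle | hgt
  · rw [max_eq_right hle, max_eq_right ((htr.trans hle).trans hr)]
    exact mul_le_of_le_one_left (by positivity) hm1
  rw [max_eq_left hgt.le]
  obtain ⟨k, hk, k', hk', hkk, hkk', hb, hc, hs⟩ := exists_conj_norm_le A
  have htrace : (k * A * k').trace = A.trace := by
    rw [Matrix.trace_mul_comm, ← mul_assoc, hkk', one_mul]
  have hconj := measure_anticommKer_le_conj μ hμ A X hk hk' hkk hkk'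
  set β := ‖(k * A * k') 0 1‖
  have hdiag : ∀ {s : ℝ}, ‖A.trace‖ ≤ s → β ≤ s → boxNorm A ≤ s := by
    intro s h1 h3
    have h00 : ‖A 0 0‖ = ‖A.trace + (A 0 0 - A 1 1)‖ := by
      rw [Matrix.trace_fin_two, ← one_mul ‖A 0 0‖, ← h2, ← norm_mul]; congr 1; ring
    have h11 : ‖A 1 1‖ = ‖A.trace - (A 0 0 - A 1 1)‖ := by
      rw [Matrix.trace_fin_two, ← one_mul ‖A 1 1‖, ← h2, ← norm_mul]; congr 1; ring
    refine (boxNorm_le_iff ((norm_nonneg _).trans h1)).2 ?_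
    simp only [Fin.forall_fin_two]
    refine ⟨⟨?_, hb.trans h3⟩, hc.trans h3, ?_⟩
    · rw [h00]; exact norm_add_le_of h1 (hs.trans h3)
    · rw [h11]; exact norm_sub_le_of h1 (hs.trans h3)
  rcases le_or_gt ‖A.trace‖ β with hτ | hτ
  · have hN : boxNorm A ≤ β := hdiag hτ le_rfl
    have hN0 := boxNorm_nonneg A
    have e1 : m * β ^ 2 ≤ ‖X‖ ^ 2 :=
      (mul_le_mul_of_nonneg_right hconj (by positivity)).trans
        (measure_anticommKer_mul_sq_le h hq μ hμ h2 hX (k * A * k'))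
    have e2 : m * (β ^ 2 * ‖A.trace‖) ≤ ‖X‖ ^ 3 := by
      have := measure_anticommKer_mul_sq_mul_trace_le h hq μ hμ h2 hX (k * A * k')
      rw [htrace] at this
      exact (mul_le_mul_of_nonneg_right hconj (by positivity)).trans this
    have e3 : ‖X‖ ^ 3 ≤ r * ‖X‖ ^ 2 := by
      rw [pow_succ']; gcongr
    rcases max_cases ‖A.trace‖ r with ⟨hmax, -⟩ | ⟨hmax, -⟩ <;> rw [hmax]
    · calc m * (‖A.trace‖ * boxNorm A ^ 2) ≤ m * (‖A.trace‖ * β ^ 2) := by gcongr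
        _ = m * (β ^ 2 * ‖A.trace‖) := by ring
        _ ≤ _ := e2.trans e3
    · calc m * (r * boxNorm A ^ 2) ≤ m * (r * β ^ 2) := by gcongr
        _ = r * (m * β ^ 2) := by ring
        _ ≤ _ := by gcongr
  · have hN : boxNorm A = ‖A.trace‖ := le_antisymm (hdiag le_rfl hτ.le) htr
    have e1 : m * ‖A.trace‖ ^ 3 ≤ ‖X‖ ^ 3 :=
      measure_anticommKer_mul_trace_le h hq μ hμ h2 hX A
    rw [hN] at hgt ⊢
    have e3 : ‖X‖ ^ 3 ≤ r * ‖X‖ ^ 2 := by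
      rw [pow_succ']; gcongr
    rcases max_cases ‖A.trace‖ r with ⟨hmax, -⟩ | ⟨hmax, -⟩ <;> rw [hmax]
    · calc _ = m * ‖A.trace‖ ^ 3 := by ring
        _ ≤ _ := e1.trans e3
    · have e4 : m * ‖A.trace‖ ^ 2 ≤ ‖X‖ ^ 2 := by
        refine le_of_mul_le_mul_right ?_ (hX0.trans hgt)
        calc m * ‖A.trace‖ ^ 2 * ‖A.trace‖ = m * ‖A.trace‖ ^ 3 := by ring
          _ ≤ ‖X‖ ^ 2 * ‖X‖ := e1.trans_eq (by ring)
          _ ≤ _ := by gcongr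
      calc _ = r * (m * ‖A.trace‖ ^ 2) := by ring
        _ ≤ _ := by gcongr

end Conjugation

/-! ### Lattice duality for the trace pairing. -/

section Duality

variable {F : Type*} [NontriviallyNormedField F]

lemma IsUniformizer.exists_norm_eq_pow {ϖ : F} (h : IsUniformizer ϖ) {x : F} (hx : x ≠ 0)
    (hx1 : ‖x‖ ≤ 1) : ∃ k : ℕ, ‖x‖ = ‖ϖ‖ ^ k := by
  obtain ⟨k, hk⟩ := h.exists_norm_eq_zpow hx
  have hk0 : 0 ≤ k := by
    by_contra! hlt
    have := one_lt_zpow_of_neg₀ (norm_pos_iff.2 h.1) h.2.1 hlt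
    rw [← hk] at this
    exact absurd hx1 (not_le.2 this)
  lift k to ℕ using hk0
  exact ⟨k, by simpa using hk⟩

/-- A lattice in `Fⁿ` is the dual of its dual lattice; version relative to coordinate subspaces. -/
lemma exists_dual_vector_of_support {ϖ : F} (h : IsUniformizer ϖ) {ι : Type*} [Fintype ι]
    [DecidableEq ι] (M : AddSubgroup (ι → F)) (hsmul : ∀ c : F, ‖c‖ ≤ 1 → ∀ m ∈ M, c • m ∈ M)
    (hbdd : ∀ m ∈ M, ∀ i, ‖m i‖ ≤ 1) {X : F} (hX0 : X ≠ 0) (hX : ∀ i, Pi.single i X ∈ M)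
    (s : Finset ι) : ∀ x : ι → F, (∀ i ∉ s, x i = 0) → x ∉ M →
    ∃ T : ι → F, (∀ m ∈ M, (∀ i ∉ s, m i = 0) → ‖∑ i, T i * m i‖ ≤ 1) ∧
      1 < ‖∑ i, T i * x i‖ := by
  classical
  induction s using Finset.induction_on with
  | empty =>
    intro x hx hxM
    exact absurd (by rw [show x = 0 from funext fun i => hx i (by simp)]; exact M.zero_mem) hxM
  | insert j s hj ih =>
    intro x hx hxM
    -- The least such `k` gives a vector `m₀` of `M`, supported on `insert j s`, with `j`-th
    -- coordinate of maximal norm; it exists because the value group is discrete.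
    have hex : ∃ k : ℕ, ∃ m ∈ M, (∀ i ∉ insert j s, m i = 0) ∧ ‖m j‖ = ‖ϖ‖ ^ k := by
      obtain ⟨k, hk⟩ := h.exists_norm_eq_pow hX0 (by simpa using hbdd _ (hX j) j)
      refine ⟨k, _, hX j, fun i hi => ?_, by simpa using hk⟩
      rw [Pi.single_apply, if_neg]
      rintro rfl
      exact hi (Finset.mem_insert_self _ _)
    obtain ⟨m₀, hm₀, hm₀s, hm₀j⟩ := Nat.find_spec hex
    have hmax (m : ι → F) (hm : m ∈ M) (hms : ∀ i ∉ insert j s, m i = 0) :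
        ‖m j‖ ≤ ‖m₀ j‖ := by
      by_cases h0 : m j = 0
      · rw [h0, norm_zero]; exact norm_nonneg _
      · obtain ⟨k, hk⟩ := h.exists_norm_eq_pow h0 (hbdd m hm j)
        rw [hk, hm₀j]
        exact pow_le_pow_of_le_one (norm_nonneg _) h.2.1.le (Nat.find_min' hex ⟨m, hm, hms, hk⟩)
    have hj0 : m₀ j ≠ 0 := by
      rw [← norm_pos_iff, hm₀j]
      exact pow_pos (norm_pos_iff.2 h.1) _
    have hred (y : ι → F) (hys : ∀ i ∉ insert j s, y i = 0) (i : ι) (hi : i ∉ s) :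
        (y - (y j / m₀ j) • m₀) i = 0 := by
      rcases eq_or_ne i j with rfl | hij
      · simp [hj0]
      · have : i ∉ insert j s := by simp [hij, hi]
        simp [hys i this, hm₀s i this]
    by_cases hc : ‖x j / m₀ j‖ ≤ 1
    · obtain ⟨T, hT1, hT2⟩ := ih (x - (x j / m₀ j) • m₀) (hred x hx) (fun hmem => hxM (by
        simpa using M.add_mem hmem (hsmul _ hc _ hm₀)))
      -- The `j`-th coordinate is chosen so that `T'` annihilates `m₀`; pairing `y` with `T'` then
      -- amounts to pairing its reduction along `m₀` with `T`.
      set T' : ι → F := Function.update T j (-(∑ i ∈ Finset.univ.erase j, T i * m₀ i) / m₀ j)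
      have hT'j : T' j * m₀ j = -(∑ i ∈ Finset.univ.erase j, T i * m₀ i) := by
        simp [T', hj0]
      have hT'm₀ : ∑ i, T' i * m₀ i = 0 := by
        rw [← Finset.add_sum_erase _ _ (Finset.mem_univ j), hT'j, neg_add_eq_zero]
        refine Finset.sum_congr rfl fun i hi => ?_
        simp [T', (Finset.mem_erase.1 hi).1]
      have hT'y (y : ι → F) (hys : ∀ i ∉ insert j s, y i = 0) :
          ∑ i, T' i * y i = ∑ i, T i * (y - (y j / m₀ j) • m₀) i := by
        have h1 : ∑ i, T' i * y i = ∑ i, T' i * (y - (y j / m₀ j) • m₀) i := by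
          have : ∑ i, T' i * ((y j / m₀ j) • m₀) i = 0 := by
            simp only [Pi.smul_apply, smul_eq_mul, mul_left_comm (T' _)]
            rw [← Finset.mul_sum, hT'm₀, mul_zero]
          simp only [Pi.sub_apply, mul_sub, Finset.sum_sub_distrib]
          rw [this, sub_zero]
        rw [h1]
        refine Finset.sum_congr rfl fun i _ => ?_
        rcases eq_or_ne i j with rfl | hij
        · rw [hred y hys i hj, mul_zero, mul_zero]
        · simp [T', hij]
      refine ⟨T', fun m hm hms => ?_, by rwa [hT'y x hx]⟩
      rw [hT'y m hms]
      refine hT1 _ (M.sub_mem hm (hsmul _ ?_ _ hm₀)) (hred m hms)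
      rw [norm_div]
      exact div_le_one_of_le₀ (hmax m hm hms) (norm_nonneg _)
    -- Here the `j`-th coordinate alone, scaled by `m₀ j`, separates `x` from `M`.
    · refine ⟨Pi.single j (m₀ j)⁻¹, fun m hm hms => ?_, ?_⟩
      · simp only [Pi.single_apply, ite_mul, zero_mul, Finset.sum_ite_eq', Finset.mem_univ,
          if_true]
        rw [norm_mul, norm_inv, inv_mul_le_one₀ (norm_pos_iff.2 hj0)]
        exact hmax m hm hms
      · simp only [Pi.single_apply, ite_mul, zero_mul, Finset.sum_ite_eq', Finset.mem_univ,
          if_true]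
        rw [inv_mul_eq_div]
        exact not_le.1 hc

variable [IsUltrametricDist F]

/-- The map `Y ↦ AY + YA` is self-adjoint for the trace form, so a functional integral on the
lattice `{AY + YA + XB}` is represented by some `S` with `XS` in `anticommKer A X`. The hypothesis
on `γ` says that no such functional separates it from the lattice. -/
lemma exists_eq_anticomm_add_smul {ϖ : F} (h : IsUniformizer ϖ) {A : D F} (hA : A ∈ OD F)
    {X : F} (hX0 : X ≠ 0) (hX1 : ‖X‖ ≤ 1) {γ : D F}
    (hγ : ∀ T ∈ anticommKer A X, ‖(γ * T).trace‖ ≤ ‖X‖) :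
    ∃ Y ∈ OD F, ∃ B ∈ OD F, γ = A * Y + Y * A + X • B := by
  let toMat (v : Fin 2 × Fin 2 → F) : D F := Matrix.of fun i j => v (i, j)
  let M : AddSubgroup (Fin 2 × Fin 2 → F) :=
    { carrier := {v | ∃ Y ∈ OD F, ∃ B ∈ OD F, toMat v = A * Y + Y * A + X • B}
      add_mem' := by
        rintro v w ⟨Y, hY, B, hB, hv⟩ ⟨Y', hY', B', hB', hw⟩
        refine ⟨Y + Y', add_mem_OD hY hY', B + B', add_mem_OD hB hB', ?_⟩
        rw [show toMat (v + w) = toMat v + toMat w from rfl, hv, hw, smul_add]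
        noncomm_ring
      zero_mem' := ⟨0, zero_mem_OD, 0, zero_mem_OD, by
        rw [show toMat 0 = 0 from rfl]; simp⟩
      neg_mem' := by
        rintro v ⟨Y, hY, B, hB, hv⟩
        refine ⟨-Y, neg_mem_OD hY, -B, neg_mem_OD hB, ?_⟩
        rw [show toMat (-v) = -toMat v from rfl, hv, smul_neg]
        noncomm_ring }
  have hmemM (Y B : D F) (hY : Y ∈ OD F) (hB : B ∈ OD F) :
      (fun p => (A * Y + Y * A + X • B) p.1 p.2) ∈ M := ⟨Y, hY, B, hB, rfl⟩
  by_contra hcon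
  obtain ⟨T, hT1, hT2⟩ := exists_dual_vector_of_support h M
    (by
      rintro c hc v ⟨Y, hY, B, hB, hv⟩
      refine ⟨c • Y, smul_mem_OD hc hY, c • B, smul_mem_OD hc hB, ?_⟩
      rw [show toMat (c • v) = c • toMat v from rfl, hv, smul_add, smul_add, smul_comm X c]
      simp)
    (by
      rintro v ⟨Y, hY, B, hB, hv⟩ ⟨i, j⟩
      rw [show v (i, j) = toMat v i j from rfl, hv]
      exact add_mem_OD (add_mem_OD (mul_mem_OD hA hY) (mul_mem_OD hY hA)) (smul_mem_OD hX1 hB) i j)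
    hX0
    (by
      rintro ⟨i, j⟩
      refine ⟨0, zero_mem_OD, Matrix.single i j 1, fun a b => ?_, ?_⟩
      · rw [Matrix.single_apply]; split_ifs <;> simp
      · ext a b
        simp [toMat, Matrix.single_apply, Pi.single_apply, Prod.ext_iff, eq_comm])
    Finset.univ (fun p => γ p.1 p.2) (by simp)
    (by rintro ⟨Y, hY, B, hB, hv⟩; exact hcon ⟨Y, hY, B, hB, hv⟩)
  let S : D F := Matrix.of fun i j => T (j, i)
  have hpair (C : D F) : ∑ p, T p * C p.1 p.2 = (C * S).trace := by
    simp only [Fintype.sum_prod_type, Fin.sum_univ_two, Matrix.trace_fin_two, Matrix.mul_apply, S,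
      Matrix.of_apply]
    ring
  have hS1 : X • S ∈ OD F := mem_OD_of_norm_trace_mul_le fun B hB => by
    have := hT1 _ (hmemM 0 B zero_mem_OD hB) (by simp)
    rw [hpair] at this
    rw [Matrix.trace_mul_comm]
    simpa using this
  have hS2 : A * S + S * A ∈ OD F := mem_OD_of_norm_trace_mul_le fun Y hY => by
    have := hT1 _ (hmemM Y 0 hY zero_mem_OD) (by simp)
    rw [hpair] at this
    convert this using 2
    rw [smul_zero, add_zero, add_mul, add_mul, Matrix.trace_add, Matrix.trace_add,
      mul_assoc S, Matrix.trace_mul_comm S, Matrix.trace_mul_comm (A * S), ← mul_assoc, add_comm]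
  have hS3 := hγ (X • S) ⟨hS1, fun i j => by
    rw [mul_smul_comm, smul_mul_assoc, ← smul_add, Matrix.smul_apply, smul_eq_mul, norm_mul]
    exact mul_le_of_le_one_right (norm_nonneg _) (hS2 i j)⟩
  rw [hpair] at hT2
  rw [mul_smul_comm, Matrix.trace_smul, smul_eq_mul, norm_mul] at hS3
  have hXp := norm_pos_iff.2 hX0
  nlinarith

end Duality

/-! ### The generator `N₀` and consequences of the shape `AY + YA + XB`. -/

section Generator

variable {F : Type*} [NontriviallyNormedField F] [IsUltrametricDist F]

/-- The intended `P` is a rank one matrix congruent to `η` modulo `det η`; for such `P` the products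
`P† A P` lie on a line, and the congruence becomes an exact identity. -/
lemma isGen_of_eq_add_smul {η P E N₀ : D F} (hP : P ∈ OD F) (hE : E ∈ OD F) (hN : N₀ ∈ OD F)
    (hηm : η ∈ OD F) (hη : η = P + η.det • E)
    (h : ∀ A ∈ OD F, ∃ c : F, ‖c‖ ≤ 1 ∧ P.adjugate * (A - c • N₀) * P = 0) : IsGen η N₀ := by
  refine ⟨hN, fun A hA => ?_⟩
  obtain ⟨c, hc, h0⟩ := h A hA
  set d := η.det
  set C := A - c • N₀
  have hC : C ∈ OD F := sub_mem_OD hA (smul_mem_OD hc hN)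
  have hd : ‖d‖ ≤ 1 := norm_det_le_one hηm
  have hadj : η.adjugate = P.adjugate + d • E.adjugate := by
    rw [hη]
    ext i j
    fin_cases i <;> fin_cases j <;> simp [Matrix.adjugate_fin_two] <;> ring
  refine ⟨c, hc, P.adjugate * C * E + E.adjugate * C * (P + d • E), ?_, ?_⟩
  · have hP' := adjugate_mem_OD hP
    have hE' := adjugate_mem_OD hE
    exact add_mem_OD (mul_mem_OD (mul_mem_OD hP' hC) hE) (mul_mem_OD (mul_mem_OD hE' hC)
      (add_mem_OD hP (smul_mem_OD hd hE)))
  · have h1 : η.adjugate * C * η = d • (P.adjugate * C * E + E.adjugate * C * (P + d • E)) := by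
      conv_lhs => rw [hadj, hη]
      simp only [add_mul, mul_add, smul_mul_assoc, mul_smul_comm, smul_add, h0]
      abel
    rw [← h1]
    simp only [C, mul_sub, sub_mul, mul_smul_comm, smul_mul_assoc]
    abel

lemma exists_isGen_of_row_zero {η : D F} (hη : η ∈ OD F) {t : F} (ht : ‖t‖ ≤ 1) {v : Fin 2 → F}
    (hv : ∀ j, ‖v j‖ ≤ 1) (hrow : ∀ j, η 1 j = t * η 0 j + η.det * v j) :
    IsGen η (Matrix.single 1 0 1) := by
  refine isGen_of_eq_add_smul (P := !![η 0 0, η 0 1; t * η 0 0, t * η 0 1])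
    (E := !![0, 0; v 0, v 1]) ?_ ?_ (fun i j => ?_) hη ?_ fun A hA =>
    -- With `P = u w`, where `u` is the column `(1, t)` and `w` the top row of `η`, `P† A P` depends
    -- on `A` only through `(-t, 1) A u`. This scalar is 1 for the chosen matrix unit.
    ⟨A 1 0 + t * A 1 1 - t * (A 0 0 + t * A 0 1), ?_, ?_⟩
  · have hm (j : Fin 2) : ‖t * η 0 j‖ ≤ 1 := by
      rw [norm_mul]; exact mul_le_one₀ ht (norm_nonneg _) (hη _ _)
    simp only [norm_mul] at hm
    intro i j
    fin_cases i <;> fin_cases j <;> simp [hη 0 0, hη 0 1, hm]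
  · intro i j
    fin_cases i <;> fin_cases j <;> simp [hv]
  · rw [Matrix.single_apply]; split_ifs <;> simp
  · ext i j
    fin_cases i <;> fin_cases j <;> simp [hrow]
  · have hm {x y : F} (hx : ‖x‖ ≤ 1) (hy : ‖y‖ ≤ 1) : ‖x + t * y‖ ≤ 1 := by
      refine norm_add_le_of hx ?_
      rw [norm_mul]; exact mul_le_one₀ ht (norm_nonneg _) hy
    rw [sub_eq_add_neg, ← mul_neg]
    exact hm (hm (hA _ _) (hA _ _)) (by rw [norm_neg]; exact hm (hA _ _) (hA _ _))
  · ext i j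
    fin_cases i <;> fin_cases j <;>
    simp [Matrix.adjugate_fin_two, Matrix.mul_apply, Matrix.vecMul, dotProduct, Fin.sum_univ_two] <;>
    ring

lemma exists_isGen_of_row_one {η : D F} (hη : η ∈ OD F) {t : F} (ht : ‖t‖ ≤ 1) {v : Fin 2 → F}
    (hv : ∀ j, ‖v j‖ ≤ 1) (hrow : ∀ j, η 0 j = t * η 1 j + η.det * v j) :
    IsGen η (Matrix.single 0 1 1) := by
  refine isGen_of_eq_add_smul (P := !![t * η 1 0, t * η 1 1; η 1 0, η 1 1])
    (E := !![v 0, v 1; 0, 0]) ?_ ?_ (fun i j => ?_) hη ?_ fun A hA =>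
    ⟨A 0 1 + t * A 0 0 - t * (A 1 1 + t * A 1 0), ?_, ?_⟩
  · have hm (j : Fin 2) : ‖t * η 1 j‖ ≤ 1 := by
      rw [norm_mul]; exact mul_le_one₀ ht (norm_nonneg _) (hη _ _)
    simp only [norm_mul] at hm
    intro i j
    fin_cases i <;> fin_cases j <;> simp [hη 1 0, hη 1 1, hm]
  · intro i j
    fin_cases i <;> fin_cases j <;> simp [hv]
  · rw [Matrix.single_apply]; split_ifs <;> simp
  · ext i j
    fin_cases i <;> fin_cases j <;> simp [hrow]
  · have hm {x y : F} (hx : ‖x‖ ≤ 1) (hy : ‖y‖ ≤ 1) : ‖x + t * y‖ ≤ 1 := by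
      refine norm_add_le_of hx ?_
      rw [norm_mul]; exact mul_le_one₀ ht (norm_nonneg _) hy
    rw [sub_eq_add_neg, ← mul_neg]
    exact hm (hm (hA _ _) (hA _ _)) (by rw [norm_neg]; exact hm (hA _ _) (hA _ _))
  · ext i j
    fin_cases i <;> fin_cases j <;>
    simp [Matrix.adjugate_fin_two, Matrix.mul_apply, Matrix.vecMul, dotProduct, Fin.sum_univ_two] <;>
    ring

/-- A unit entry makes the other row a multiple of its own row modulo `det η`. -/
lemma exists_isGen_of_norm_eq_one {η : D F} (hη : η ∈ OD F) {i j : Fin 2} (hij : ‖η i j‖ = 1) :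
    ∃ N₀ : D F, IsGen η N₀ := by
  have hne : η i j ≠ 0 := by rw [← norm_pos_iff, hij]; exact one_pos
  have hdiv {x : F} (hx : ‖x‖ ≤ 1) : ‖x / η i j‖ ≤ 1 := by rwa [norm_div, hij, div_one]
  have hdet := Matrix.det_fin_two η
  fin_cases i <;> fin_cases j
  · refine ⟨_, exists_isGen_of_row_zero hη (hdiv (hη 1 0)) (v := ![0, 1 / η 0 0])
      (Fin.forall_fin_two.2 ⟨by simp, hdiv norm_one.le⟩) (Fin.forall_fin_two.2 ⟨?_, ?_⟩)⟩ <;>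
    simp at hne ⊢ <;> (try rw [hdet]) <;> (field_simp; try ring)
  · refine ⟨_, exists_isGen_of_row_zero hη (hdiv (hη 1 1)) (v := ![-1 / η 0 1, 0])
      (Fin.forall_fin_two.2 ⟨hdiv (by simp), by simp⟩) (Fin.forall_fin_two.2 ⟨?_, ?_⟩)⟩ <;>
    simp at hne ⊢ <;> (try rw [hdet]) <;> (field_simp; try ring)
  · refine ⟨_, exists_isGen_of_row_one hη (hdiv (hη 0 0)) (v := ![0, -1 / η 1 0])
      (Fin.forall_fin_two.2 ⟨by simp, hdiv (by simp)⟩) (Fin.forall_fin_two.2 ⟨?_, ?_⟩)⟩ <;>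
    simp at hne ⊢ <;> (try rw [hdet]) <;> (field_simp; try ring)
  · refine ⟨_, exists_isGen_of_row_one hη (hdiv (hη 0 1)) (v := ![1 / η 1 1, 0])
      (Fin.forall_fin_two.2 ⟨hdiv norm_one.le, by simp⟩) (Fin.forall_fin_two.2 ⟨?_, ?_⟩)⟩ <;>
    simp at hne ⊢ <;> (try rw [hdet]) <;> (field_simp; try ring)

variable {η N₀ Z : D F} {X p : F}

/-- Right multiplication by `η` turns `Zη†Y` into `Z(η†Yη)`, to which the generator applies, and
`YZη†` into `det(η) YZ`. -/
lemma exists_mul_eq_smul_add {γ : D F} (hη : η ∈ OD F) (hN : IsGen η N₀) (hZ : Z ∈ OD F)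
    (hp : ‖p‖ ≤ 1) (h : ∃ Y ∈ OD F, ∃ B ∈ OD F,
      γ = Z * η.adjugate * Y + Y * (Z * η.adjugate) + (p * η.det) • B) :
    ∃ c : F, ‖c‖ ≤ 1 ∧ ∃ C ∈ OD F,
      γ * η = c • (Z * η.adjugate * N₀ * η) + η.det • C := by
  obtain ⟨Y, hY, B, hB, hγ⟩ := h
  obtain ⟨c, hc, B', hB', hcB⟩ := hN.2 Y hY
  refine ⟨c, hc, Z * B' + Y * Z + p • (B * η), add_mem_OD (add_mem_OD (mul_mem_OD hZ hB')
    (mul_mem_OD hY hZ)) (smul_mem_OD hp (mul_mem_OD hB hη)), ?_⟩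
  calc γ * η = Z * (η.adjugate * Y * η) + Y * Z * (η.adjugate * η) +
        ((p * η.det) • B) * η := by rw [hγ]; noncomm_ring
    _ = _ := by
      rw [hcB, Matrix.adjugate_mul, mul_comm p, mul_smul]
      simp only [mul_add, mul_smul_comm, smul_mul_assoc, smul_add, mul_one, mul_assoc]
      abel

/-- Comparing the two expressions for `γᵢη`, multiply on the right by `η†` and cancel `det η`. -/
lemma mem_thetaSet_of_cond {M₀ : D F} {n : ℕ} {m c : Fin n → F} {γ : Fin n → D F}
    (hdet : η.det ≠ 0) (hZ : Z ∈ OD F) (hc : ∀ i, ‖c i‖ ≤ 1)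
    (hγ : ∀ i, ∃ C ∈ OD F, γ i * η = c i • (Z * η.adjugate * N₀ * η) + η.det • C)
    (hcond : Cond η γ M₀ m) : Z ∈ thetaSet η N₀ M₀ m := by
  refine ⟨hZ, c, hc, fun i => ?_⟩
  obtain ⟨C, hC, h1⟩ := hγ i
  obtain ⟨B, hB, h2⟩ := hcond i
  refine ⟨C - B, sub_mem_OD hC hB, ?_⟩
  have h3 : m i • (M₀ * η) = c i • (Z * η.adjugate * N₀ * η) + η.det • (C - B) := by
    rw [smul_sub, ← add_sub_assoc, ← h1, h2, add_sub_cancel_right]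
  have h4 := congr_arg (fun U => U * η.adjugate) h3
  simp only [add_mul, smul_mul_assoc, mul_assoc, Matrix.mul_adjugate] at h4
  simp only [mul_smul_comm, mul_one, smul_comm _ η.det, ← smul_add] at h4
  have h5 := smul_right_injective (D F) hdet h4
  simpa only [mul_assoc] using h5

/-- Factor out the coefficient `c j` of largest norm: the quotients form a vector with `j`-th
coordinate 1, hence primitive. If all `c i` vanish, `M₀ = 0` works. -/
lemma cond_of_forall_exists {n : ℕ} (hn : 1 ≤ n) {ϖ : F} (hϖ : IsUniformizer ϖ) {c : Fin n → F}
    (hη : η ∈ OD F) (hN : N₀ ∈ OD F) (hZ : Z ∈ OD F) {γ : Fin n → D F} (hc : ∀ i, ‖c i‖ ≤ 1)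
    (hγ : ∀ i, ∃ C ∈ OD F, γ i * η = c i • (Z * η.adjugate * N₀ * η) + η.det • C) :
    ∃ M₀ ∈ OD F, ∃ m : Fin n → F, IsPrimitiveVec ϖ m ∧ Cond η γ M₀ m := by
  have : Nonempty (Fin n) := ⟨⟨0, hn⟩⟩
  obtain ⟨j, hj⟩ := Finite.exists_max fun i => ‖c i‖
  have hprim {m : Fin n → F} (hm : ∀ i, ‖m i‖ ≤ 1) (hmj : m j = 1) : IsPrimitiveVec ϖ m := by
    refine ⟨hm, ?_⟩
    rintro ⟨l, hl, hml⟩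
    have h1 : ‖ϖ‖ * ‖l j‖ = 1 := by
      rw [← norm_mul, ← smul_eq_mul, ← Pi.smul_apply, ← hml, hmj, norm_one]
    have := hl j
    have := hϖ.2.1
    nlinarith [norm_nonneg ϖ, norm_nonneg (l j)]
  by_cases h0 : c j = 0
  · refine ⟨0, zero_mem_OD, 1, hprim (by simp) rfl, fun i => ?_⟩
    obtain ⟨C, hC, h1⟩ := hγ i
    refine ⟨C, hC, ?_⟩
    have : c i = 0 := by
      have := hj i; rw [h0, norm_zero] at this; exact norm_le_zero_iff.1 this
    rw [h1, this]; simp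
  · refine ⟨c j • (Z * η.adjugate * N₀), smul_mem_OD (hc j) (mul_mem_OD (mul_mem_OD hZ
      (adjugate_mem_OD hη)) hN), fun i => c i / c j, hprim (fun i => ?_) (div_self h0), fun i => ?_⟩
    · rw [norm_div]; exact div_le_one_of_le₀ (hj i) (norm_nonneg _)
    · obtain ⟨C, hC, h1⟩ := hγ i
      refine ⟨C, hC, ?_⟩
      rw [h1, smul_mul_assoc, smul_smul, div_mul_cancel₀ _ h0]

lemma norm_le_max_of_eq_anticomm {A γ Y B : D F} (hY : Y ∈ OD F) (hB : B ∈ OD F)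
    (hγ : γ = A * Y + Y * A + X • B) (i j : Fin 2) : ‖γ i j‖ ≤ max (boxNorm A) ‖X‖ := by
  rw [hγ, Matrix.add_apply, Matrix.add_apply]
  refine norm_add_le_of ((norm_add_le_of (r := boxNorm A) ?_ ?_).trans (le_max_left _ _)) ?_
  · simpa using norm_mul_apply_le (norm_le_boxNorm A) hY i j
  · simpa using norm_mul_apply_le hY (norm_le_boxNorm A) i j
  · refine le_trans ?_ (le_max_right _ _)
    rw [Matrix.smul_apply, smul_eq_mul, norm_mul]
    exact mul_le_of_le_one_right (norm_nonneg _) (hB i j)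

lemma norm_sub_adjugate_mul_le {γ Y B : D F} (hη : η ∈ OD F) (hZ : Z ∈ OD F) (hp : ‖p‖ ≤ 1)
    (hY : Y ∈ OD F) (hB : B ∈ OD F)
    (hγ : γ = Z * η.adjugate * Y + Y * (Z * η.adjugate) + (p * η.det) • B) (i j : Fin 2) :
    ‖((γ - γ.adjugate) * η) i j‖ ≤ max ‖(Z * η.adjugate).trace‖ ‖η.det‖ := by
  -- For 2×2 matrices `AY + YA` equals `tr(A) Y + tr(Y) A` plus a scalar. Subtracting adjugates
  -- removes the scalar, and `(A - A†)η = 2 det(η) Z - tr(A) η` for `A = Zη†`.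
  have hid : (γ - γ.adjugate) * η =
      (Z * η.adjugate).trace • ((Y - Y.adjugate) * η - Y.trace • η) +
      η.det • ((2 * Y.trace) • Z + p • ((B - B.adjugate) * η)) := by
    rw [hγ]
    ext i j
    fin_cases i <;> fin_cases j <;>
    simp [Matrix.adjugate_fin_two, Matrix.trace_fin_two, Matrix.mul_apply, Fin.sum_univ_two,
      Matrix.det_fin_two] <;> ring
  have hYt : ‖Y.trace‖ ≤ 1 := norm_trace_le hY
  have h2 : ‖(2 : F)‖ ≤ 1 := by
    rw [← one_add_one_eq_two]; exact norm_add_le_of norm_one.le norm_one.le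
  rw [hid, Matrix.add_apply]
  refine norm_add_le_of (le_trans ?_ (le_max_left _ _)) (le_trans ?_ (le_max_right _ _)) <;>
  rw [Matrix.smul_apply, smul_eq_mul, norm_mul] <;>
  refine mul_le_of_le_one_right (norm_nonneg _) ?_
  · exact sub_mem_OD (mul_mem_OD (sub_mem_OD hY (adjugate_mem_OD hY)) hη) (smul_mem_OD hYt hη) i j
  · refine add_mem_OD (smul_mem_OD ?_ hZ) (smul_mem_OD hp
      (mul_mem_OD (sub_mem_OD hB (adjugate_mem_OD hB)) hη)) i j
    rw [norm_mul]; exact mul_le_one₀ h2 (norm_nonneg _) hYt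

end Generator

/-! ### Character orthogonality and Gaussian integrals over `O_D`. -/

section Character

open scoped ComplexConjugate

variable {F : Type*} [NontriviallyNormedField F] {ϖ : F} {ψ : AddChar F Circle}

lemma IsUnramified.continuous (hψ : IsUnramified ϖ ψ) : Continuous fun x => (ψ x : ℂ) := by
  refine continuous_iff_continuousAt.2 fun x => ?_
  refine (continuousAt_const (y := (ψ x : ℂ))).congr ?_
  filter_upwards [Metric.closedBall_mem_nhds x one_pos] with y hy
  rw [mem_closedBall_iff_norm] at hy
  rw [← sub_add_cancel y x, ψ.map_add_eq_mul, hψ.1 _ hy, one_mul]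

/-- If `|t| > 1`, then `t O_F` contains `ϖ⁻¹ O_F`, on which `ψ` is nontrivial. -/
lemma IsUnramified.norm_le_one (hϖ : IsUniformizer ϖ) (hψ : IsUnramified ϖ ψ) {t : F}
    (ht : ∀ x, ‖x‖ ≤ 1 → ψ (t * x) = 1) : ‖t‖ ≤ 1 := by
  by_contra! hlt
  have ht0 : t ≠ 0 := by rw [← norm_pos_iff]; linarith
  have h1 : ‖t⁻¹‖ ≤ ‖ϖ‖ := hϖ.2.2 _ (by rw [norm_inv]; exact inv_lt_one_of_one_lt₀ hlt)
  obtain ⟨x, hx, hne⟩ := hψ.2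
  refine hne ?_
  have h0 : 0 < ‖ϖ‖ := norm_pos_iff.2 hϖ.1
  have h2 := ht (t⁻¹ * (ϖ⁻¹ * x)) (by
    rw [norm_mul, norm_mul, norm_inv ϖ]
    calc ‖t⁻¹‖ * (‖ϖ‖⁻¹ * ‖x‖) ≤ ‖ϖ‖ * (‖ϖ‖⁻¹ * 1) := by gcongr
      _ = 1 := by field_simp)
  rwa [mul_inv_cancel_left₀ ht0] at h2

lemma coe_addChar_sum {ι : Type*} (s : Finset ι) (f : ι → F) :
    (ψ (∑ i ∈ s, f i) : ℂ) = ∏ i ∈ s, (ψ (f i) : ℂ) := by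
  classical
  induction s using Finset.induction_on with
  | empty => simp
  | insert i s hi ih =>
    rw [Finset.sum_insert hi, Finset.prod_insert hi, ψ.map_add_eq_mul, Circle.coe_mul, ih]

variable [IsUltrametricDist F] [ProperSpace F] [MeasurableSpace (D F)] [BorelSpace (D F)]
  (μ : Measure (D F)) [μ.IsAddHaarMeasure] (hμ : μ (OD F) = 1)

omit [IsUltrametricDist F] [ProperSpace F] [BorelSpace (D F)] [μ.IsAddHaarMeasure] in
include hμ in
lemma isProbabilityMeasure_restrict_OD : IsProbabilityMeasure (μ.restrict (OD F)) :=
  ⟨by rw [Measure.restrict_apply_univ, hμ]⟩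

lemma setIntegral_OD_add_right (f : D F → ℂ) {T : D F} (hT : T ∈ OD F) :
    ∫ Y in OD F, f (Y + T) ∂μ = ∫ Y in OD F, f Y ∂μ := by
  rw [← integral_indicator measurableSet_OD, ← integral_indicator measurableSet_OD,
    ← integral_add_right_eq_self ((OD F).indicator f) T]
  congr 1
  ext Y
  have : Y + T ∈ OD F ↔ Y ∈ OD F :=
    ⟨fun h => by simpa using sub_mem_OD h hT, fun h => add_mem_OD h hT⟩
  by_cases hY : Y ∈ OD F
  · rw [Set.indicator_of_mem hY, Set.indicator_of_mem (this.2 hY)]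
  · rw [Set.indicator_of_notMem hY, Set.indicator_of_notMem (fun h => hY (this.1 h))]

include hμ in
lemma setIntegral_addChar_trace_mul (hϖ : IsUniformizer ϖ) (hψ : IsUnramified ϖ ψ) (C : D F) :
    ∫ Z in OD F, (ψ ((C * Z).trace) : ℂ) ∂μ = Set.indicator (OD F) 1 C := by
  by_cases hC : C ∈ OD F
  · rw [Set.indicator_of_mem hC, setIntegral_congr_fun measurableSet_OD (g := fun _ => 1)]
    · simp [Measure.real, hμ]
    · intro Z hZ
      simp only
      rw [hψ.1 _ (norm_trace_le (mul_mem_OD hC hZ)), Circle.coe_one]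
  · rw [Set.indicator_of_notMem hC]
    obtain ⟨T, hT, hne⟩ : ∃ T ∈ OD F, ψ ((C * T).trace) ≠ 1 := by
      by_contra! hcon
      refine hC (mem_OD_of_norm_trace_mul_le fun T hT => hψ.norm_le_one hϖ fun x hx => ?_)
      rw [← hcon _ (smul_mem_OD hx hT)]
      simp [mul_comm]
    have h1 := setIntegral_OD_add_right μ (fun Z => (ψ ((C * Z).trace) : ℂ)) hT
    simp only [mul_add, Matrix.trace_add, ψ.map_add_eq_mul, Circle.coe_mul] at h1
    rw [integral_mul_const] at h1
    by_contra h0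
    exact hne (Circle.ext (by simpa using mul_left_cancel₀ h0 (h1.trans (mul_one _).symm)))

/-- The argument of the character in the Gaussian integral attached to `Y ↦ υ tr(A Y²)`. -/
def phase (υ X : F) (A γ Y : D F) : F := (υ * (A * Y ^ 2).trace + (γ * Y).trace) / X

/-- The Gaussian integral over `O_D` with quadratic part `υ tr(A Y²) / X`. -/
def gaussInt (ψ : AddChar F Circle) (υ X : F) (A γ : D F) : ℂ :=
  ∫ Y in OD F, (ψ (phase υ X A γ Y) : ℂ) ∂μ

omit [IsUltrametricDist F] [ProperSpace F] [MeasurableSpace (D F)] [BorelSpace (D F)] in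
lemma phase_add (υ X : F) (A γ Y T : D F) :
    phase υ X A γ (Y + T) =
      phase υ X A γ Y + phase υ X A γ T + ((υ / X) • (A * T + T * A) * Y).trace := by
  have h : (A * Y * T).trace = (T * A * Y).trace := by
    rw [Matrix.trace_mul_comm, mul_assoc]
  simp only [phase, sq, mul_add, add_mul, Matrix.trace_add, smul_mul_assoc, Matrix.trace_smul,
    smul_eq_mul, h, ← mul_assoc, smul_add]
  ring

omit [IsUltrametricDist F] [ProperSpace F] [MeasurableSpace (D F)] [BorelSpace (D F)] in
lemma continuous_phase (υ X : F) (A γ : D F) : Continuous (phase υ X A γ) := by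
  unfold phase
  fun_prop

omit [ProperSpace F] [MeasurableSpace (D F)] [BorelSpace (D F)] in
-- Since `2 tr(AT²) = tr((AT + TA)T)` and 2 is a unit, the quadratic part of the phase is integral
-- on the kernel.
lemma addChar_phase_of_mem_anticommKer (hψ : IsUnramified ϖ ψ) (h2 : ‖(2 : F)‖ = 1) {υ X : F}
    (hυ : ‖υ‖ = 1) {A γ T : D F} (hT : T ∈ anticommKer A X) :
    ψ (phase υ X A γ T) = ψ ((γ * T).trace / X) := by
  have h20 : (2 : F) ≠ 0 := by rw [← norm_pos_iff, h2]; exact one_pos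
  rw [phase, add_div, ψ.map_add_eq_mul, hψ.1, one_mul]
  have h3 : (A * T ^ 2).trace = ((A * T + T * A) * T).trace / 2 := by
    rw [eq_div_iff h20, add_mul, Matrix.trace_add, mul_assoc T, Matrix.trace_mul_comm T,
      sq, ← mul_assoc]
    ring
  refine norm_div_le_one ?_
  rw [norm_mul, hυ, one_mul, h3, norm_div, h2, div_one]
  refine norm_trace_le fun i j => ?_
  simpa using norm_mul_apply_le hT.2 hT.1 i j

/-- Translating by `T` multiplies the integral by `ψ(tr(γT)/X)`, which must be 1. Applying this to
all integral multiples of `T` gives integrality of the argument. -/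
lemma norm_trace_mul_le_of_gaussInt_ne_zero (hϖ : IsUniformizer ϖ) (hψ : IsUnramified ϖ ψ)
    (h2 : ‖(2 : F)‖ = 1) {υ X : F} (hυ : ‖υ‖ = 1) (hX : X ≠ 0) {A γ : D F}
    (hg : gaussInt μ ψ υ X A γ ≠ 0) {T : D F} (hT : T ∈ anticommKer A X) :
    ‖(γ * T).trace‖ ≤ ‖X‖ := by
  have key {T : D F} (hT : T ∈ anticommKer A X) : ψ ((γ * T).trace / X) = 1 := by
    have h1 := setIntegral_OD_add_right μ (fun Y => (ψ (phase υ X A γ Y) : ℂ)) hT.1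
    have h3 : ∀ Y ∈ OD F, (ψ (phase υ X A γ (Y + T)) : ℂ) =
        ψ (phase υ X A γ Y) * ψ ((γ * T).trace / X) := by
      intro Y hY
      have h4 : ψ (((υ / X) • (A * T + T * A) * Y).trace) = 1 := by
        refine hψ.1 _ (norm_trace_le (mul_mem_OD (fun i j => ?_) hY))
        rw [Matrix.smul_apply, smul_eq_mul, div_mul_eq_mul_div, mul_div_assoc, norm_mul, hυ,
          one_mul]
        exact norm_div_le_one (hT.2 i j)
      rw [phase_add, ψ.map_add_eq_mul, ψ.map_add_eq_mul, h4, mul_one,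
        addChar_phase_of_mem_anticommKer hψ h2 hυ hT, Circle.coe_mul]
    rw [setIntegral_congr_fun measurableSet_OD h3, integral_mul_const] at h1
    exact Circle.ext (by simpa using mul_left_cancel₀ hg (h1.trans (mul_one _).symm))
  have h1 : ‖(γ * T).trace / X‖ ≤ 1 := by
    refine hψ.norm_le_one hϖ fun x hx => ?_
    rw [← key (T := x • T) ⟨smul_mem_OD hx hT.1, fun i j => ?_⟩]
    · rw [mul_smul_comm, Matrix.trace_smul, smul_eq_mul]
      congr 1
      ring
    · rw [mul_smul_comm, smul_mul_assoc, ← smul_add, Matrix.smul_apply, smul_eq_mul, norm_mul]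
      exact (mul_le_of_le_one_left (norm_nonneg _) hx).trans (hT.2 i j)
  rwa [norm_div, div_le_one (norm_pos_iff.2 hX)] at h1

include hμ in
-- Weyl differencing: in `|G|²` the substitution `T + Y` leaves a phase linear in `Y`, and
-- integrating over `Y` kills every `T` outside the kernel.
lemma norm_gaussInt_sq_le (hϖ : IsUniformizer ϖ) (hψ : IsUnramified ϖ ψ)
    {υ X : F} (hυ : ‖υ‖ = 1) (hX : X ≠ 0) (A γ : D F) :
    ‖gaussInt μ ψ υ X A γ‖ ^ 2 ≤ μ.real (anticommKer A X) := by
  have := isProbabilityMeasure_restrict_OD μ hμ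
  set χ : D F → ℂ := fun Y => (ψ (phase υ X A γ Y) : ℂ)
  have hχ : Continuous χ := hψ.continuous.comp (continuous_phase υ X A γ)
  set κ : D F → D F → ℂ := fun T Y => (ψ (((υ / X) • (A * T + T * A) * Y).trace) : ℂ)
  have hχκ (Y T : D F) : χ (T + Y) = χ Y * (χ T * κ T Y) := by
    simp only [χ, κ]
    rw [add_comm T, phase_add, ψ.map_add_eq_mul, ψ.map_add_eq_mul, Circle.coe_mul,
      Circle.coe_mul, mul_assoc]
  have hconj (Y : D F) : conj (χ Y) * χ Y = 1 := by
    rw [← Complex.normSq_eq_conj_mul_self, Complex.normSq_eq_norm_sq, Circle.norm_coe]; simp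
  have hsq : ((‖gaussInt μ ψ υ X A γ‖ ^ 2 : ℝ) : ℂ) =
      ∫ T in OD F, χ T * ∫ Y in OD F, κ T Y ∂μ ∂μ := by
    calc ((‖gaussInt μ ψ υ X A γ‖ ^ 2 : ℝ) : ℂ)
        = conj (gaussInt μ ψ υ X A γ) * gaussInt μ ψ υ X A γ := by
          rw [← Complex.normSq_eq_conj_mul_self, Complex.normSq_eq_norm_sq]
      _ = ∫ Y in OD F, conj (χ Y) * gaussInt μ ψ υ X A γ ∂μ := by
          rw [integral_mul_const, integral_conj]; rfl
      _ = ∫ Y in OD F, ∫ T in OD F, χ T * κ T Y ∂μ ∂μ := by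
          refine setIntegral_congr_fun measurableSet_OD fun Y hY => ?_
          rw [gaussInt, ← setIntegral_OD_add_right μ _ hY, ← integral_const_mul]
          refine integral_congr_ae (.of_forall fun T => ?_)
          change conj (χ Y) * χ (T + Y) = _
          rw [hχκ, ← mul_assoc, hconj, one_mul]
      _ = ∫ T in OD F, ∫ Y in OD F, χ T * κ T Y ∂μ ∂μ := by
          refine integral_integral_swap ?_
          refine Integrable.of_bound (C := 1) (Continuous.aestronglyMeasurable ?_)
            (.of_forall fun p => ?_)
          · refine (hχ.comp continuous_snd).mul (hψ.continuous.comp ?_)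
            fun_prop
          · exact (norm_mul _ _).trans_le (mul_le_one₀ (Circle.norm_coe _).le (norm_nonneg _)
              (Circle.norm_coe _).le)
      _ = _ := by simp_rw [integral_const_mul]
  have hH : ∀ T ∈ OD F, T ∉ anticommKer A X → ∫ Y in OD F, κ T Y ∂μ = 0 := by
    intro T hT hTH
    simp only [κ]
    rw [setIntegral_addChar_trace_mul μ hμ hϖ hψ, Set.indicator_of_notMem]
    refine fun hmem => hTH ⟨hT, fun i j => ?_⟩
    have h1 := hmem i j
    rw [Matrix.smul_apply, smul_eq_mul, norm_mul, norm_div, hυ, one_div,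
      inv_mul_le_one₀ (norm_pos_iff.2 hX)] at h1
    exact h1
  have hbd (T : D F) : ‖χ T * ∫ Y in OD F, κ T Y ∂μ‖ ≤ 1 := by
    rw [norm_mul, Circle.norm_coe, one_mul]
    refine (norm_integral_le_of_norm_le_const (C := 1) (.of_forall fun Y => ?_)).trans ?_
    · exact (Circle.norm_coe _).le
    · simp
  have hmain : ‖((‖gaussInt μ ψ υ X A γ‖ ^ 2 : ℝ) : ℂ)‖ ≤ μ.real (anticommKer A X) := by
    rw [hsq, ← integral_indicator measurableSet_OD,
      ← setIntegral_eq_integral_of_forall_compl_eq_zero (s := anticommKer A X)]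
    · refine (norm_setIntegral_le_of_norm_le_const (C := 1) ?_ fun T hT => ?_).trans ?_
      · exact (measure_mono fun Y hY => hY.1).trans_lt (hμ ▸ ENNReal.one_lt_top)
      · rw [Set.indicator_of_mem hT.1]; exact hbd T
      · rw [one_mul]
    · intro T hT
      by_cases hT' : T ∈ OD F
      · rw [Set.indicator_of_mem hT', hH T hT' hT, mul_zero]
      · exact Set.indicator_of_notMem hT' _
  rwa [Complex.norm_real, Real.norm_of_nonneg (by positivity)] at hmain

end Character

/-! ### Fourier expansion of the integrality condition. -/

section Unfolding

variable {F : Type*} [NontriviallyNormedField F] {ϖ : F} {ψ : AddChar F Circle}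
  [IsUltrametricDist F] [ProperSpace F] [MeasurableSpace (D F)] [BorelSpace (D F)]
  (μ : Measure (D F)) [μ.IsAddHaarMeasure] (hμ : μ (OD F) = 1)

omit [IsUltrametricDist F] [ProperSpace F] [BorelSpace (D F)] [μ.IsAddHaarMeasure] in
lemma I0_eq_zero_of_notMem {n : ℕ} (P : (Fin n → D F) → D F) (f : (Fin n → D F) → ℂ) {δ : D F}
    (hδ : δ ∉ OD F) (γ : Fin n → D F) : I0 μ ψ P f (stdΦ F) δ γ = 0 := by
  have : ∀ Y, stdΦ F (δ, δ⁻¹ * P Y) = 0 := fun Y =>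
    Set.indicator_of_notMem (fun h => hδ h.1) _
  simp [I0, this]

include hμ in
theorem I0_eq_integral_prod (hϖ : IsUniformizer ϖ) (hψ : IsUnramified ϖ ψ) {n : ℕ}
    (υ : Fin n → F) {δ : D F} (hδ : δ ∈ OD F) (γ : Fin n → D F) :
    I0 μ ψ (diagForm υ) (stdf F n) (stdΦ F) δ γ = ∫ Z in OD F, ∏ i, ∫ Y in OD F,
      (ψ (υ i * (Z * δ⁻¹ * Y ^ 2).trace + (γ i * Y).trace / δ.det) : ℂ) ∂μ ∂μ := by
  have := isProbabilityMeasure_restrict_OD μ hμ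
  have hset : {Y : Fin n → D F | ∀ i, Y i ∈ OD F} = Set.univ.pi fun _ => OD F := by
    ext Y; simp
  have hms : MeasurableSet (Set.univ.pi fun _ : Fin n => OD F) :=
    MeasurableSet.univ_pi fun _ => measurableSet_OD
  have hP : Continuous (diagForm υ : (Fin n → D F) → D F) := by
    unfold diagForm
    fun_prop
  have harg (Z : D F) (Y : Fin n → D F) :
      (δ⁻¹ * diagForm υ Y * Z).trace + (∑ i, γ i * Y i).trace / δ.det =
        ∑ i, (υ i * (Z * δ⁻¹ * Y i ^ 2).trace + (γ i * Y i).trace / δ.det) := by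
    rw [Finset.sum_add_distrib, Matrix.trace_mul_comm, ← mul_assoc, diagForm, Finset.mul_sum,
      Matrix.trace_sum, Matrix.trace_sum, Finset.sum_div]
    simp
  calc I0 μ ψ (diagForm υ) (stdf F n) (stdΦ F) δ γ
      = ∫ Y in Set.univ.pi fun _ => OD F, stdΦ F (δ, δ⁻¹ * diagForm υ Y) *
          (ψ ((∑ i, γ i * Y i).trace / δ.det) : ℂ) ∂(Measure.pi fun _ => μ) := by
        rw [I0, ← integral_indicator hms]
        congr 1
        ext Y
        rw [stdf, hset]
        by_cases hY : Y ∈ Set.univ.pi fun _ => OD F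
        · rw [Set.indicator_of_mem hY, Set.indicator_of_mem hY, Pi.one_apply, one_mul]
        · rw [Set.indicator_of_notMem hY, Set.indicator_of_notMem hY, zero_mul, zero_mul]
    _ = ∫ Y, ∫ Z in OD F, (ψ (∑ i, (υ i * (Z * δ⁻¹ * Y i ^ 2).trace +
          (γ i * Y i).trace / δ.det)) : ℂ) ∂μ ∂(Measure.pi fun _ => μ.restrict (OD F)) := by
        rw [Measure.restrict_pi_pi]
        congr 1
        ext Y
        have h1 : stdΦ F (δ, δ⁻¹ * diagForm υ Y) =
            ∫ Z in OD F, (ψ ((δ⁻¹ * diagForm υ Y * Z).trace) : ℂ) ∂μ := by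
          rw [setIntegral_addChar_trace_mul μ hμ hϖ hψ, stdΦ]
          by_cases hC : δ⁻¹ * diagForm υ Y ∈ OD F
          · rw [Set.indicator_of_mem hC, Set.indicator_of_mem (Set.mk_mem_prod hδ hC)]; rfl
          · rw [Set.indicator_of_notMem hC, Set.indicator_of_notMem fun h => hC h.2]
        rw [h1, ← integral_mul_const]
        congr 1
        ext Z
        rw [← Circle.coe_mul, ← ψ.map_add_eq_mul, harg]
    _ = ∫ Z in OD F, ∫ Y, (ψ (∑ i, (υ i * (Z * δ⁻¹ * Y i ^ 2).trace +
          (γ i * Y i).trace / δ.det)) : ℂ) ∂(Measure.pi fun _ => μ.restrict (OD F)) ∂μ := by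
        refine integral_integral_swap ?_
        refine Integrable.of_bound (C := 1) (Continuous.aestronglyMeasurable ?_)
          (.of_forall fun p => ?_)
        · refine hψ.continuous.comp ?_
          fun_prop
        · exact (Circle.norm_coe _).le
    _ = _ := by
        congr 1
        ext Z
        rw [← integral_fintype_prod_eq_prod]
        congr 1
        ext Y
        exact coe_addChar_sum _ _

end Unfolding

/-! ### Normalization by the primitive part and final estimates. -/

section Final

variable {F : Type*} [NontriviallyNormedField F] {ϖ : F}

lemma exists_norm_eq_boxNorm (x : D F) : ∃ i j, ‖x i j‖ = boxNorm x := by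
  obtain ⟨p, hp⟩ := Finite.exists_max fun p : Fin 2 × Fin 2 => ‖x p.1 p.2‖
  exact ⟨p.1, p.2, le_antisymm (norm_le_boxNorm x _ _)
    ((boxNorm_le_iff (norm_nonneg _)).2 fun i j => hp (i, j))⟩

lemma boxNorm_eq_zpow_ordD (hϖ : IsUniformizer ϖ) {x : D F} (hx : x ≠ 0) :
    boxNorm x = ‖ϖ‖ ^ ordD ϖ x := by
  have h0 : 0 < ‖ϖ‖ := norm_pos_iff.2 hϖ.1
  obtain ⟨i, j, hij⟩ := exists_norm_eq_boxNorm x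
  have hne : x i j ≠ 0 := by
    intro h
    rw [h, norm_zero] at hij
    refine hx (Matrix.ext fun a b => norm_le_zero_iff.1 ?_)
    rw [hij]
    exact norm_le_boxNorm x a b
  obtain ⟨k, hk⟩ := hϖ.exists_norm_eq_zpow hne
  have hmem (e : ℤ) : (∃ y ∈ OD F, x = ϖ ^ e • y) ↔ e ≤ k := by
    rw [← zpow_le_zpow_iff_right_of_lt_one₀ h0 hϖ.2.1, ← hk]
    constructor
    · rintro ⟨y, hy, rfl⟩
      rw [Matrix.smul_apply, smul_eq_mul, norm_mul, norm_zpow]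
      exact mul_le_of_le_one_right (by positivity) (hy i j)
    · intro h
      refine exists_mem_OD_eq_smul (zpow_ne_zero _ hϖ.1) fun a b => ?_
      rw [norm_zpow]
      exact (norm_le_boxNorm x a b).trans (hij.symm.trans_le h)
  -- The set of exponents is `Set.Iic k`, nonempty and bounded above, so its integer supremum is a
  -- true maximum and not the default value.
  have hord : ordD ϖ x = k := by
    have : {e : ℤ | ∃ y ∈ OD F, x = ϖ ^ e • y} = Set.Iic k := Set.ext hmem
    rw [ordD, this, csSup_Iic]
  rw [hord, ← hk, hij]

lemma boxNorm_smul (c : F) (x : D F) : boxNorm (c • x) = ‖c‖ * boxNorm x := by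
  rw [boxNorm, boxNorm, ← norm_smul]
  rfl

lemma boxNormVec_le_iff {n : ℕ} {x : Fin n → D F} {r : ℝ} (hr : 0 ≤ r) :
    boxNormVec x ≤ r ↔ ∀ i a b, ‖x i a b‖ ≤ r := by
  rw [boxNormVec, pi_norm_le_iff_of_nonneg hr]
  exact ⟨fun h i a b => h (i, a, b), fun h p => h p.1 p.2.1 p.2.2⟩

lemma mem_OD_iff_boxNorm_le {x : D F} : x ∈ OD F ↔ boxNorm x ≤ 1 :=
  (boxNorm_le_iff zero_le_one).symm

lemma boxNorm_primitivePart (hϖ : IsUniformizer ϖ) {δ η : D F} (hδ : δ ≠ 0)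
    (hη : δ = ϖ ^ ordD ϖ δ • η) : boxNorm η = 1 := by
  have h1 : boxNorm δ = ‖ϖ ^ ordD ϖ δ‖ * boxNorm η := by
    conv_lhs => rw [hη]
    exact boxNorm_smul _ _
  rw [boxNorm_eq_zpow_ordD hϖ hδ, norm_zpow] at h1
  have h0 : ‖ϖ‖ ^ ordD ϖ δ ≠ 0 := zpow_ne_zero _ (norm_ne_zero_iff.2 hϖ.1)
  exact (mul_left_cancel₀ h0 (h1.symm.trans (mul_one _).symm))

/-- Here `det δ = p² det η`, and one factor `p` cancels against that of `p • γ`, leaving the common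
denominator `p det η`. -/
lemma phase_eq {p : F} {δ η : D F} (hp : p ≠ 0) (hd : η.det ≠ 0) (hη : δ = p • η) (υ : F)
    (Z γ Y : D F) :
    υ * (Z * δ⁻¹ * Y ^ 2).trace + ((p • γ) * Y).trace / δ.det =
      phase υ (p * η.det) (Z * η.adjugate) γ Y := by
  have hinv : δ⁻¹ = (p * η.det)⁻¹ • η.adjugate := by
    refine Matrix.inv_eq_right_inv ?_
    rw [hη, smul_mul_smul_comm, Matrix.mul_adjugate, smul_smul]
    rw [show p * (p * η.det)⁻¹ * η.det = 1 by field_simp, one_smul]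
  have hdet : δ.det = p * (p * η.det) := by
    rw [hη, Matrix.det_smul]; simp; ring
  rw [hinv, hdet, phase, mul_smul_comm, smul_mul_assoc, smul_mul_assoc, Matrix.trace_smul,
    Matrix.trace_smul, smul_eq_mul, smul_eq_mul, mul_div_mul_left _ _ hp]
  field_simp

variable [IsUltrametricDist F] [ProperSpace F] [MeasurableSpace (D F)] [BorelSpace (D F)]
  {ψ : AddChar F Circle} (μ : Measure (D F)) [μ.IsAddHaarMeasure] (hμ : μ (OD F) = 1)

include hμ in
lemma I0_eq_integral_prod_gaussInt (hϖ : IsUniformizer ϖ) (hψ : IsUnramified ϖ ψ) {n : ℕ}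
    (υ : Fin n → F) {δ η : D F} (hδ : δ ∈ OD F) {p : F} (hp : p ≠ 0) (hd : η.det ≠ 0)
    (hη : δ = p • η) (γ : Fin n → D F) :
    I0 μ ψ (diagForm υ) (stdf F n) (stdΦ F) δ (p • γ) =
      ∫ Z in OD F, ∏ i, gaussInt μ ψ (υ i) (p * η.det) (Z * η.adjugate) (γ i) ∂μ := by
  rw [I0_eq_integral_prod μ hμ hϖ hψ υ hδ]
  simp only [gaussInt, Pi.smul_apply, phase_eq hp hd hη]

lemma exists_eq_anticomm_of_gaussInt_ne_zero (hϖ : IsUniformizer ϖ) (hψ : IsUnramified ϖ ψ)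
    (h2 : ‖(2 : F)‖ = 1) {υ p : F} (hυ : ‖υ‖ = 1) {η Z γ : D F} (hη : η ∈ OD F) (hp : p ≠ 0)
    (hp1 : ‖p‖ ≤ 1) (hd : η.det ≠ 0) (hZ : Z ∈ OD F)
    (hg : gaussInt μ ψ υ (p * η.det) (Z * η.adjugate) γ ≠ 0) :
    ∃ Y ∈ OD F, ∃ B ∈ OD F,
      γ = Z * η.adjugate * Y + Y * (Z * η.adjugate) + (p * η.det) • B := by
  refine exists_eq_anticomm_add_smul hϖ (mul_mem_OD hZ (adjugate_mem_OD hη)) (mul_ne_zero hp hd) ?_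
    fun T hT => norm_trace_mul_le_of_gaussInt_ne_zero μ hϖ hψ h2 hυ (mul_ne_zero hp hd) hg hT
  rw [norm_mul]
  exact mul_le_one₀ hp1 (norm_nonneg _) (norm_det_le_one hη)

omit [IsUltrametricDist F] [ProperSpace F] [BorelSpace (D F)] [μ.IsAddHaarMeasure] in
include hμ in
lemma measure_thetaSet_le_W {n : ℕ} {m : Fin n → F} (hm : IsPrimitiveVec ϖ m) (η N₀ M₀ : D F) :
    μ.real (thetaSet η N₀ M₀ m) ≤ W μ ϖ n η N₀ M₀ := by
  -- The bound 1, the volume of `O_D`, makes the supremum a genuine one; an unbounded family would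
  -- give the default 0.
  refine le_ciSup (f := fun m : {m : Fin n → F // IsPrimitiveVec ϖ m} =>
    μ.real (thetaSet η N₀ M₀ m.1)) ⟨1, ?_⟩ ⟨m, hm⟩
  rintro _ ⟨m', rfl⟩
  have h1 : μ (thetaSet η N₀ M₀ m'.1) ≤ 1 := hμ ▸ measure_mono fun Z hZ => hZ.1
  simpa [Measure.real] using ENNReal.toReal_mono ENNReal.one_ne_top h1

omit [IsUltrametricDist F] [ProperSpace F] [BorelSpace (D F)] [μ.IsAddHaarMeasure] in
lemma W_nonneg (n : ℕ) (η N₀ M₀ : D F) : 0 ≤ W μ ϖ n η N₀ M₀ :=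
  Real.iSup_nonneg fun _ => measureReal_nonneg

/-- Taking square roots of the volume bound and multiplying over `n` factors gives the exponents
`3n/2`, `n/2` and `n`. -/
lemma prod_le_of_sq_le {n : ℕ} {g : Fin n → ℝ} {m d p K M : ℝ} (hg0 : ∀ i, 0 ≤ g i)
    (hg : ∀ i, g i ^ 2 ≤ m) (hd : 0 ≤ d) (hp : 0 ≤ p) (hK : 0 < K) (hM : 0 < M)
    (hm : m * (K * M ^ 2) ≤ d * (p * d) ^ 2) :
    ∏ i, g i ≤ d ^ (3 * (n : ℝ) / 2) * p ^ n / (K ^ ((n : ℝ) / 2) * M ^ n) := by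
  have hsq {x : ℝ} (hx : 0 ≤ x) : (x ^ 2) ^ ((n : ℝ) / 2) = x ^ n := by
    rw [← Real.rpow_natCast x 2, ← Real.rpow_mul hx, ← Real.rpow_natCast]
    congr 1
    push_cast
    ring
  have hcube : (d ^ 3) ^ ((n : ℝ) / 2) = d ^ (3 * (n : ℝ) / 2) := by
    rw [← Real.rpow_natCast d 3, ← Real.rpow_mul hd]
    congr 1
    push_cast
    ring
  have hle : m ≤ d ^ 3 * p ^ 2 / (K * M ^ 2) := by
    rw [le_div_iff₀ (by positivity)]
    exact hm.trans_eq (by ring)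
  set c := d ^ 3 * p ^ 2 / (K * M ^ 2)
  have hc : 0 ≤ c := by positivity
  calc ∏ i, g i ≤ ∏ _i : Fin n, √c :=
        Finset.prod_le_prod (fun i _ => hg0 i) fun i _ => Real.le_sqrt_of_sq_le ((hg i).trans hle)
    _ = √c ^ n := by simp
    _ = c ^ ((n : ℝ) / 2) := by rw [← hsq (Real.sqrt_nonneg c), Real.sq_sqrt hc]
    _ = _ := by
      rw [Real.div_rpow (by positivity) (by positivity), Real.mul_rpow (by positivity)
        (by positivity), Real.mul_rpow (by positivity) (by positivity), hsq hp, hsq hM.le, hcube]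

end Final

end SplitPlace

end

/-! ### Assembly of the vanishing statement and the bound. -/

open SplitPlace

theorem theorem7p2
    {F : Type*} [NontriviallyNormedField F] [IsUltrametricDist F] [ProperSpace F]
    [MeasurableSpace (SplitPlace.D F)] [BorelSpace (SplitPlace.D F)]
    (ϖ : F) (hϖ : SplitPlace.IsUniformizer ϖ)
    -- the absolute value is the normalized one
    (hq : ‖ϖ‖ = ((SplitPlace.residueCard F : ℝ))⁻¹)
    -- the residue characteristic is odd
    (h2 : ‖(2 : F)‖ = 1)
    (ψ : AddChar F Circle) (hψ : SplitPlace.IsUnramified ϖ ψ)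
    -- the Haar measure on `D` that is self-dual for `ψ`
    (μ : MeasureTheory.Measure (SplitPlace.D F)) [μ.IsAddHaarMeasure]
    (hμ : μ (SplitPlace.OD F) = 1)
    {n : ℕ} (hn : 1 ≤ n) (υ : Fin n → F) (hυ : ∀ i, ‖υ i‖ = 1)
    (δ η : SplitPlace.D F) (hδ : IsUnit δ) (hη : δ = ϖ ^ SplitPlace.ordD ϖ δ • η)
    (γ : Fin n → SplitPlace.D F) :
    -- the auxiliary element `N₀` in the definition of `𝒲` exists
    (∃ N₀ : SplitPlace.D F, SplitPlace.IsGen η N₀) ∧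
    -- vanishing
    (SplitPlace.I0 μ ψ (SplitPlace.diagForm υ) (SplitPlace.stdf F n) (SplitPlace.stdΦ F) δ γ ≠ 0 →
      ∃ γ' : Fin n → SplitPlace.D F, (∀ i, γ' i ∈ SplitPlace.OD F) ∧
        γ = ϖ ^ SplitPlace.ordD ϖ δ • γ' ∧
        ∃ M₀ ∈ SplitPlace.OD F, ∃ m : Fin n → F, SplitPlace.IsPrimitiveVec ϖ m ∧
          SplitPlace.Cond η γ' M₀ m) ∧
    -- the bound
    (∀ γ' : Fin n → SplitPlace.D F, (∀ i, γ' i ∈ SplitPlace.OD F) →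
      γ = ϖ ^ SplitPlace.ordD ϖ δ • γ' →
      ∀ M₀ ∈ SplitPlace.OD F, ∀ m : Fin n → F, SplitPlace.IsPrimitiveVec ϖ m →
        SplitPlace.Cond η γ' M₀ m →
        ∀ N₀ : SplitPlace.D F, SplitPlace.IsGen η N₀ →
        ‖SplitPlace.I0 μ ψ (SplitPlace.diagForm υ) (SplitPlace.stdf F n)
            (SplitPlace.stdΦ F) δ γ‖ ≤
          SplitPlace.W μ ϖ n η N₀ M₀ * ‖η.det‖ ^ (3 * (n : ℝ) / 2) *
              SplitPlace.boxNorm δ ^ n /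
            (max (SplitPlace.boxNormVec fun i => (γ' i - (γ' i).adjugate) * η) ‖η.det‖
                ^ ((n : ℝ) / 2) *
              max (SplitPlace.boxNormVec γ') (SplitPlace.boxNorm δ * ‖η.det‖) ^ n)) := by
  have hδ0 : δ ≠ 0 := hδ.ne_zero
  have hbη := boxNorm_primitivePart hϖ hδ0 hη
  have hbδ := boxNorm_eq_zpow_ordD hϖ hδ0
  have hηO : η ∈ OD F := mem_OD_iff_boxNorm_le.2 hbη.le
  set p := ϖ ^ ordD ϖ δ with hpdef
  have hp : p ≠ 0 := zpow_ne_zero _ hϖ.1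
  rw [← norm_zpow, ← hpdef] at hbδ
  have hd : η.det ≠ 0 := by
    have h1 : δ.det ≠ 0 := ((Matrix.isUnit_iff_isUnit_det δ).1 hδ).ne_zero
    rw [hη, Matrix.det_smul] at h1
    exact right_ne_zero_of_mul h1
  obtain ⟨i₀, j₀, hij⟩ := exists_norm_eq_boxNorm η
  obtain ⟨N, hN⟩ := exists_isGen_of_norm_eq_one hηO (hij.trans hbη)
  have hX : p * η.det ≠ 0 := mul_ne_zero hp hd
  refine ⟨⟨N, hN⟩, fun hI => ?_, ?_⟩
  · have hδO : δ ∈ OD F := by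
      by_contra hcon
      exact hI (I0_eq_zero_of_notMem μ _ _ hcon γ)
    have hp1 : ‖p‖ ≤ 1 := hbδ ▸ mem_OD_iff_boxNorm_le.1 hδO
    have hγ : γ = p • (p⁻¹ • γ) := by rw [smul_smul, mul_inv_cancel₀ hp, one_smul]
    rw [hγ, I0_eq_integral_prod_gaussInt μ hμ hϖ hψ υ hδO hp hd hη] at hI
    obtain ⟨Z, hZ, hprod⟩ : ∃ Z ∈ OD F,
        ∏ i, gaussInt μ ψ (υ i) (p * η.det) (Z * η.adjugate) ((p⁻¹ • γ) i) ≠ 0 := by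
      by_contra! hcon
      exact hI (setIntegral_eq_zero_of_forall_eq_zero hcon)
    have hrep (i : Fin n) := exists_eq_anticomm_of_gaussInt_ne_zero μ hϖ hψ h2 (hυ i) hηO hp hp1
      hd hZ (Finset.prod_ne_zero_iff.1 hprod i (Finset.mem_univ i))
    have hZη := mul_mem_OD hZ (adjugate_mem_OD hηO)
    refine ⟨p⁻¹ • γ, fun i => ?_, hγ, ?_⟩
    · obtain ⟨Y, hY, B, hB, h⟩ := hrep i
      rw [h]
      refine add_mem_OD (add_mem_OD (mul_mem_OD hZη hY) (mul_mem_OD hY hZη)) (smul_mem_OD ?_ hB)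
      rw [norm_mul]
      exact mul_le_one₀ hp1 (norm_nonneg _) (norm_det_le_one hηO)
    · choose c hc1 hc2 using fun i =>
        exists_mul_eq_smul_add hηO hN hZ hp1 (hrep i)
      exact cond_of_forall_exists hn hϖ hηO hN.1 hZ hc1 hc2
  · intro γ' hγ'O hγ M₀ hM₀ m hm hcond N₀ hN₀
    set K := max (boxNormVec fun i => (γ' i - (γ' i).adjugate) * η) ‖η.det‖
    set M := max (boxNormVec γ') (boxNorm δ * ‖η.det‖)
    have hd0 : 0 < ‖η.det‖ := norm_pos_iff.2 hd
    have hp0 : 0 < ‖p‖ := norm_pos_iff.2 hp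
    have hK : 0 < K := lt_max_of_lt_right hd0
    have hM : 0 < M := lt_max_of_lt_right (by rw [hbδ]; positivity)
    set C := ‖η.det‖ ^ (3 * (n : ℝ) / 2) * boxNorm δ ^ n / (K ^ ((n : ℝ) / 2) * M ^ n) with hC
    have hC0 : 0 ≤ C := by rw [hC, hbδ]; positivity
    rw [mul_assoc, mul_div_assoc, ← hC]
    by_cases hδO : δ ∈ OD F
    swap
    · rw [I0_eq_zero_of_notMem μ _ _ hδO, norm_zero]
      exact mul_nonneg (W_nonneg μ n η N₀ M₀) hC0
    have hp1 : ‖p‖ ≤ 1 := hbδ ▸ mem_OD_iff_boxNorm_le.1 hδO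
    have hrep {Z : D F} (hZ : Z ∈ OD F)
        (hprod : ∏ i, gaussInt μ ψ (υ i) (p * η.det) (Z * η.adjugate) (γ' i) ≠ 0) (i : Fin n) :=
      exists_eq_anticomm_of_gaussInt_ne_zero μ hϖ hψ h2 (hυ i) hηO hp hp1
        hd hZ (Finset.prod_ne_zero_iff.1 hprod i (Finset.mem_univ i))
    -- The integrand vanishes for `Z` outside `thetaSet η N₀ M₀ m`, so its integral is at most the
    -- volume of that set times a uniform bound.
    rw [hγ, I0_eq_integral_prod_gaussInt μ hμ hϖ hψ υ hδO hp hd hη,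
      ← integral_indicator measurableSet_OD,
      ← setIntegral_eq_integral_of_forall_compl_eq_zero (s := thetaSet η N₀ M₀ m)]
    · refine (norm_setIntegral_le_of_norm_le_const (C := C) ?_ fun Z hZ => ?_).trans ?_
      · exact (measure_mono fun Z hZ => hZ.1).trans_lt (hμ ▸ ENNReal.one_lt_top)
      · rw [Set.indicator_of_mem hZ.1]
        by_cases hprod : ∏ i, gaussInt μ ψ (υ i) (p * η.det) (Z * η.adjugate) (γ' i) = 0
        · rw [hprod, norm_zero]; exact hC0
        have hr := hrep hZ.1 hprod
        have hKle : K ≤ max ‖(Z * η.adjugate).trace‖ ‖η.det‖ := by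
          refine max_le ((boxNormVec_le_iff (by positivity)).2 fun i => ?_) (le_max_right _ _)
          obtain ⟨Y, hY, B, hB, h⟩ := hr i
          exact norm_sub_adjugate_mul_le hηO hZ.1 hp1 hY hB h
        have hMle : M ≤ max (boxNorm (Z * η.adjugate)) ‖p * η.det‖ := by
          refine max_le ((boxNormVec_le_iff (by positivity)).2 fun i => ?_) ?_
          · obtain ⟨Y, hY, B, hB, h⟩ := hr i
            exact norm_le_max_of_eq_anticomm hY hB h
          · rw [hbδ, ← norm_mul]; exact le_max_right _ _
        -- The choice `r = ‖η.det‖` matches the floor in `K`, while the floor in `M` is `|p det η| =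
        -- |X|`.
        have hvol := measure_anticommKer_le hϖ hq μ hμ h2 hX (r := ‖η.det‖)
          (by rw [norm_mul]; exact mul_le_of_le_one_left (norm_nonneg _) hp1) (Z * η.adjugate)
        rw [norm_prod, hC, hbδ]
        refine prod_le_of_sq_le (fun i => norm_nonneg _)
          (fun i => norm_gaussInt_sq_le μ hμ hϖ hψ (hυ i) hX _ _) hd0.le hp0.le hK hM ?_
        rw [← norm_mul]
        exact le_trans (by gcongr) hvol
      · rw [mul_comm]
        exact mul_le_mul_of_nonneg_right (measure_thetaSet_le_W μ hμ hm η N₀ M₀) hC0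
    · intro Z hZ
      by_cases hZO : Z ∈ OD F
      swap
      · exact Set.indicator_of_notMem hZO _
      rw [Set.indicator_of_mem hZO]
      by_contra hprod
      refine hZ ?_
      choose c hc1 hc2 using fun i =>
        exists_mul_eq_smul_add hηO hN₀ hZO hp1 (hrep hZO hprod i)
      exact mem_thetaSet_of_cond hd hZO hc1 hc2 hcond
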